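/- **Setting.** Let $1<p<\infty$, $\frac1p+\frac1{p'}=1$, and $L\ge 1$. Let $\Omega_0,\dots,\Omega_L=\Omega$ and $\Sigma_0,\dots,\Sigma_{L-1}$ be rectangular domains (open bounded non-empty rectangles $(a,b)\times(c,d)\subset\mathbb R^2$), and $\sigma:\mathbb R\to\mathbb R$ a Lipschitz continuous activation function. For a function $u$ on a rectangle $\theta$ let $\mathfrak R u$ be its extension by repeated reflection across the sides of $\theta$. For $u\in L^p(\Omega_0)$, $w=(w^l)_l\in\mathcal W^{p'}(\Sigma):=\prod_{l=0}^{L-1}L^{p'}(\Sigma_l)$ with $\|w\|_{p'}=(\sum_l\|w^l\|_{p'}^{p'})^{1/p'}$, and $b\in\mathbb R^L$ put $\mu^0=u$ and $$\mu^{l+1}=\sigma\big((\mathfrak R\mu^l)*w^l+b^l\big)\ \text{on }\Omega_{l+1}\ (l\le L-2),\qquad \mathcal{NN}(u,w,b)=(\mathfrak R\mu^{L-1})*w^{L-1}+b^{L-1}\ \text{on }\Omega,$$ where $(v*w^l)(x)=\int_{\Sigma_l}w^l(y)\,v(x-y)\,dy$. **Discretization.** If the side lengths of $\theta$ are integer multiples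 of $h>0$, divide $\theta$ into squares (cells) of side $h$, numbered $(i,j)$ from the lower left corner. $PC^h(\theta)$ is the space of functions that are constant on each cell, and $P^hv\in PC^h(\theta)$ takes on each cell the value of $v$ at the centre of the cell. Let $s_{l,D},s_{l,U}\ge1$ be integers. Downsampling $\mathfrak D_l$ by the factor $s=s_{l,D}$ replaces each block of $s\times s$ cells by one cell with the value $f_l$ of the block, $f_l:\mathbb R^{s\times s}\to\mathbb R$; upsampling $\mathfrak U_l$ by the factor $s=s_{l,U}$ replaces the cell $(i,j)$ of the function with cell values $U$ by a block of $s\times s$ cells with the values $g_l(U_{i,j},U_{i+1,j},U_{i,j+1},U_{i+1,j+1})$, $g_l:\mathbb R^{2\times2}\to\mathbb R^{s\times s}$, with constant extension of $U$ at the boundary. The functions $f_l,g_l$ are continuous, and all values of $f_l(U)$ and all entries of $g_l(U)$ lie between the smallest and the largest entry of $U$. For an input resolution $h=h_0$ let $h_{l+1}=h_l\,s_{l,D}/s_{l+1,U}$. We only consider $h$ such that the side lengths of $\Omega_0$ are integer multiples of $h_0$, and for all $l$ those of $\Sigma_l$ are integer multiples of $h_l$ and those of $\Omega_{l+1}$ are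 integer multiples of $s_{l,D}h_l$. Put $\mathcal W_h(\Sigma)=\prod_lPC^{h_l}(\Sigma_l)$. For $u^h\in PC^{h_0}(\Omega_0)$ let $v^{0}=u^h$ and $$v^{l+1}=\mathfrak U_{l+1}\mathfrak D_lP^{h_l}\sigma\big((\mathfrak Rv^l)*w^l+b^l\big)\ (l\le L-2),\qquad \mathcal{NN}_h(u^h,w,b)=\mathfrak D_{L-1}P^{h_{L-1}}\big((\mathfrak Rv^{L-1})*w^{L-1}+b^{L-1}\big).$$ **Training problems.** Let $Y$ be a real Banach space, $A:L^\infty(\Omega)\to Y$ linear and bounded, $\ell:Y\times Y\to[0,\infty]$, $\lambda,\nu>0$, $|\cdot|$ a norm on $\mathbb R^L$, and $(u_j,y_j)\in L^p(\Omega_0)\times Y$ for $j=1,\dots,N$. Let $h$ run through a sequence of positive admissible resolutions tending to $0$, and for each such $h$ let $u_j^h\in PC^{h}(\Omega_0)$ and $y_j^h\in Y$. On $\mathcal W^{p'}(\Sigma)\times\mathbb R^L$ define $$\mathcal E(w,b)=\sum_{j=1}^N\ell\big(y_j,A\,\mathcal{NN}(u_j,w,b)\big)+\lambda\|w\|_{p'}+\nu|b|,$$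 $$\mathcal E^h(w,b)=\sum_{j=1}^N\ell\big(y_j^h,A\,\mathcal{NN}_h(u_j^h,w,b)\big)+\lambda\|w\|_{p'}+\nu|b|\ \text{ if }w\in\mathcal W_h(\Sigma),\qquad \mathcal E^h(w,b)=\infty\ \text{ otherwise.}$$ **Theorem 3.11.** Assume that 1. for all $h,j$ the function $\ell(y_j^h,\cdot)$ is lower semicontinuous, and for every $h$ there is $(w,b)\in\mathcal W_h(\Sigma)\times\mathbb R^L$ with $\ell(y_j^h,A\,\mathcal{NN}_h(u_j^h,w,b))<\infty$ for all $j$; 2. for all $j$ and whenever $z^h\to z$ in $Y$ as $h\to0$, $\ell(y_j^h,z^h)\to\ell(y_j,z)$; 3. $u_j^h\to u_j$ in $L^p(\Omega_0)$ for all $j$. Then for each $h$, $\mathcal E^h$ has a minimizer. If $(\hat w^h,\hat b^h)$ is a minimizer of $\mathcal E^h$ for each $h$, then either * $\lim_{h\to0}\mathcal E^h(\hat w^h,\hat b^h)=\infty$ and $\mathcal E$ is not proper (that is, $\mathcal E\equiv\infty$), or * $\mathcal E$ is proper, $\mathcal E$ attains its minimum, and $\lim_{h\to0}\mathcal E^h(\hat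 w^h,\hat b^h)=\min\mathcal E$. In the latter case every weak accumulation point of $(\hat w^h,\hat b^h)_h$ (weak limit of a subsequence) in $\mathcal W^{p'}(\Sigma)\times\mathbb R^L$ minimizes $\mathcal E$, and there is at least one weak accumulation point. -/

import Mathlib

open MeasureTheory Filter Topology
open scoped ENNReal NNReal

noncomputable section

/-- A rectangular domain `(a, b) × (c, d)` in the plane. -/
structure Rect where
  a : ℝ
  b : ℝ
  c : ℝ
  d : ℝ
  hab : a < b
  hcd : c < d

namespace Rect

/-- The underlying open set. -/
def toSet (θ : Rect) : Set (ℝ × ℝ) := Set.Ioo θ.a θ.b ×ˢ Set.Ioo θ.c θ.d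

/-- Lebesgue measure on the rectangle. -/
abbrev vol (θ : Rect) : Measure (ℝ × ℝ) := volume.restrict θ.toSet

end Rect

/-- Folding of the real line onto `[a, b]`: it is the identity on `[a, b]` and it is invariant
under the reflections at `a` and at `b`, hence `2 (b - a)`-periodic.  On `[a - (b - a), b]` it is
`x ↦ |x - a| + a`. -/
def fold (a b x : ℝ) : ℝ :=
  a + |(x - a) - 2 * (b - a) * (round ((x - a) / (2 * (b - a))) : ℤ)|

/-- Extension by (repeated) reflection of a function on the rectangle `θ`.  It is defined on the
whole plane, and it is used on whatever larger domain is needed. -/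
def reflExt (θ : Rect) (u : ℝ × ℝ → ℝ) : ℝ × ℝ → ℝ :=
  fun x => u (fold θ.a θ.b x.1, fold θ.c θ.d x.2)

/-- The (valid) convolution `∫_Σ w(y) u(x - y) dy`, with `Σ = S`. -/
def rectConv (S : Rect) (u w : ℝ × ℝ → ℝ) (x : ℝ × ℝ) : ℝ :=
  ∫ y in S.toSet, w y * u (x - y)

/-! ### Pixel grids -/

/-- The side lengths of `θ` are integer multiples of the resolution `h`. -/
def Rect.Fits (θ : Rect) (h : ℝ) : Prop :=
  ∃ M N : ℕ, θ.b - θ.a = M * h ∧ θ.d - θ.c = N * h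

/-- The centre of the cell `(i, j)`, where `θ` is divided into squares of side `h`. -/
def Rect.center (θ : Rect) (h : ℝ) (i j : ℕ) : ℝ × ℝ :=
  (θ.a + ((i : ℝ) + 1 / 2) * h, θ.c + ((j : ℝ) + 1 / 2) * h)

/-- The function on `θ` with the constant value `U i j` on the cell
`[a + i h, a + (i + 1) h) × [c + j h, c + (j + 1) h)`. (Values outside `θ` play no role.) -/
def stepFun (θ : Rect) (h : ℝ) (U : ℕ → ℕ → ℝ) : ℝ × ℝ → ℝ :=
  fun x => U ⌊(x.1 - θ.a) / h⌋₊ ⌊(x.2 - θ.c) / h⌋₊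

/-- Membership (up to null sets) in the space of functions on `θ` that are constant on cells. -/
def IsPC (θ : Rect) (h : ℝ) (v : ℝ × ℝ → ℝ) : Prop :=
  ∃ U : ℕ → ℕ → ℝ, v =ᵐ[θ.vol] stepFun θ h U

/-- The matrix of values of `u` at the cell centres. -/
def samples (θ : Rect) (h : ℝ) (u : ℝ × ℝ → ℝ) : ℕ → ℕ → ℝ :=
  fun i j => u (θ.center h i j)

/-- The projection of pointwise defined functions onto piecewise constant functions. -/
def projPC (θ : Rect) (h : ℝ) (u : ℝ × ℝ → ℝ) : ℝ × ℝ → ℝ :=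
  stepFun θ h (samples θ h u)

/-- Downsampling by the factor `s` with the averaging function `f`, from resolution `h` to
resolution `s h`: each block of `s × s` cells becomes one cell. -/
def downsample (θ : Rect) (h : ℝ) (s : ℕ+) (f : (Fin s → Fin s → ℝ) → ℝ) (u : ℝ × ℝ → ℝ) :
    ℝ × ℝ → ℝ :=
  stepFun θ (s * h) fun k l => f fun i j => samples θ h u (s * k + i) (s * l + j)

/-- Upsampling by the factor `s` with the interpolation function `g`, from resolution `s h` to
resolution `h`.  The block of `s × s` fine cells in the coarse cell `(k, l)` receives the values
`g (U k l, U (k+1) l, U k (l+1), U (k+1) (l+1))`, with constant extension of the matrix `U` beyond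
its last row and column. -/
def upsample (θ : Rect) (h : ℝ) (s : ℕ+)
    (g : (Fin 2 → Fin 2 → ℝ) → Fin s → Fin s → ℝ) (u : ℝ × ℝ → ℝ) : ℝ × ℝ → ℝ :=
  stepFun θ h fun i j =>
    g (fun α β => samples θ (s * h) u
        (min (i / s + α) (⌊(θ.b - θ.a) / (s * h)⌋₊ - 1))
        (min (j / s + β) (⌊(θ.d - θ.c) / (s * h)⌋₊ - 1)))
      ⟨i % s, Nat.mod_lt i s.pos⟩ ⟨j % s, Nat.mod_lt j s.pos⟩

/-! ### Convolutional neural networks -/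

/-- The data of a network with `m + 1` layers, numbered `0, …, m`: the domains
`Ω 0, …, Ω (m + 1)` of the activations, the domains `S 0, …, S m` of the convolution kernels, the
activation function, and the factors and functions of the down- and upsampling in each layer
(there is no upsampling in layer `0`: `sU 0` and `g 0` are not used). -/
structure CNN (m : ℕ) where
  Ω : Fin (m + 2) → Rect
  S : Fin (m + 1) → Rect
  act : ℝ → ℝ
  sD : Fin (m + 1) → ℕ+
  sU : Fin (m + 1) → ℕ+
  f : (l : Fin (m + 1)) → (Fin (sD l) → Fin (sD l) → ℝ) → ℝ
  g : (l : Fin (m + 1)) → (Fin 2 → Fin 2 → ℝ) → Fin (sU l) → Fin (sU l) → ℝ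

namespace CNN

variable {m : ℕ}

/-- The domain of the input. -/
abbrev inRect (C : CNN m) : Rect := C.Ω 0

/-- The domain of the output. -/
abbrev outRect (C : CNN m) : Rect := C.Ω (Fin.last (m + 1))

/-- Reflection padding, convolution with `w` and addition of the bias `β` in layer `l`. -/
def affine (C : CNN m) (l : Fin (m + 1)) (w : ℝ × ℝ → ℝ) (β : ℝ) (u : ℝ × ℝ → ℝ) :
    ℝ × ℝ → ℝ :=
  fun x => rectConv (C.S l) (reflExt (C.Ω l.castSucc) u) w x + β

/-- The input of layer `l` of the function space network. -/
def layerIn (C : CNN m) (w : Fin (m + 1) → ℝ × ℝ → ℝ) (b : Fin (m + 1) → ℝ)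
    (u : ℝ × ℝ → ℝ) : (l : ℕ) → l < m + 1 → ℝ × ℝ → ℝ
  | 0, _ => u
  | l + 1, hl => fun x =>
      C.act (C.affine ⟨l, by omega⟩ (w ⟨l, by omega⟩) (b ⟨l, by omega⟩)
        (C.layerIn w b u l (by omega)) x)

/-- The function space network. -/
def fsNet (C : CNN m) (w : Fin (m + 1) → ℝ × ℝ → ℝ) (b : Fin (m + 1) → ℝ)
    (u : ℝ × ℝ → ℝ) : ℝ × ℝ → ℝ :=
  C.affine (Fin.last m) (w (Fin.last m)) (b (Fin.last m))
    (C.layerIn w b u m (Nat.lt_succ_self m))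

/-- The resolution in layer `l`, if the resolution of the input is `h`. -/
def res (C : CNN m) (h : ℝ) : (l : ℕ) → l < m + 1 → ℝ
  | 0, _ => h
  | l + 1, hl => C.res h l (by omega) * (C.sD ⟨l, by omega⟩ : ℕ) / (C.sU ⟨l + 1, hl⟩ : ℕ)

/-- The upsampled input of layer `l` of the approximated network. -/
def layerInH (C : CNN m) (h : ℝ) (w : Fin (m + 1) → ℝ × ℝ → ℝ) (b : Fin (m + 1) → ℝ)
    (u : ℝ × ℝ → ℝ) : (l : ℕ) → l < m + 1 → ℝ × ℝ → ℝ
  | 0, _ => u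
  | l + 1, hl =>
      let k : Fin (m + 1) := ⟨l, by omega⟩
      let r : ℝ := C.res h l (by omega)
      upsample (C.Ω k.succ) (C.res h (l + 1) hl) (C.sU ⟨l + 1, hl⟩) (C.g ⟨l + 1, hl⟩)
        (downsample (C.Ω k.succ) r (C.sD k) (C.f k)
          (projPC (C.Ω k.succ) r fun x =>
            C.act (C.affine k (w k) (b k) (C.layerInH h w b u l (by omega)) x)))

/-- The approximated network with input resolution `h`. -/
def approxNet (C : CNN m) (h : ℝ) (w : Fin (m + 1) → ℝ × ℝ → ℝ) (b : Fin (m + 1) → ℝ)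
    (u : ℝ × ℝ → ℝ) : ℝ × ℝ → ℝ :=
  downsample C.outRect (C.res h m (Nat.lt_succ_self m)) (C.sD (Fin.last m)) (C.f (Fin.last m))
    (projPC C.outRect (C.res h m (Nat.lt_succ_self m))
      (C.affine (Fin.last m) (w (Fin.last m)) (b (Fin.last m))
        (C.layerInH h w b u m (Nat.lt_succ_self m))))

/-- All domains are divided into cells by the grids that are used on them: the input domain at
resolution `h`, and in each layer the domain of the kernel at the resolution of the layer, and the
domain of the activation that leaves the layer at the resolution after downsampling. -/
def Fits (C : CNN m) (h : ℝ) : Prop :=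
  C.inRect.Fits h ∧ ∀ l : Fin (m + 1),
    (C.S l).Fits (C.res h l l.isLt) ∧ (C.Ω l.succ).Fits ((C.sD l : ℕ) * C.res h l l.isLt)

/-- The values of the sampling functions `f` and `g` lie between the minimum and the maximum of
the entries of their argument. -/
def SamplingBounds (C : CNN m) : Prop :=
  (∀ l U lo hi, (∀ i j, lo ≤ U i j ∧ U i j ≤ hi) → lo ≤ C.f l U ∧ C.f l U ≤ hi) ∧
  (∀ l U lo hi, (∀ i j, lo ≤ U i j ∧ U i j ≤ hi) →
    ∀ i j, lo ≤ C.g l U i j ∧ C.g l U i j ≤ hi)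

/-- The sampling functions are continuous. -/
def SamplingContinuous (C : CNN m) : Prop :=
  (∀ l, Continuous (C.f l)) ∧ (∀ l, Continuous (C.g l))

/-- The space `L^q(S 0) × ⋯ × L^q(S m)` of kernels, with norm `(∑ₗ ‖wₗ‖_q ^ q) ^ (1 / q)`. -/
abbrev Weights (C : CNN m) (q : ℝ≥0∞) : Type :=
  PiLp q fun l : Fin (m + 1) => Lp ℝ q (C.S l).vol

/-- The space of trainable parameters: kernels and biases. -/
abbrev Params (C : CNN m) (q : ℝ≥0∞) : Type := C.Weights q × (Fin (m + 1) → ℝ)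

/-- Kernels that are piecewise constant on the grids with input resolution `h`. -/
def discreteWeights (C : CNN m) (q : ℝ≥0∞) (h : ℝ) : Set (C.Weights q) :=
  {w | ∀ l : Fin (m + 1), IsPC (C.S l) (C.res h l l.isLt) (w l)}

open Classical in
/-- The class in `L^∞(θ)` of an essentially bounded function.  (The outputs of the networks are
always essentially bounded, see `coeFn_NN` and `coeFn_NNh` below, so that the default value is
never used.) -/
def toLinf (θ : Rect) (v : ℝ × ℝ → ℝ) : Lp ℝ ∞ θ.vol :=
  if hv : MemLp v ∞ θ.vol then hv.toLp v else 0

/-- The output of the function space network in `L^∞`. -/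
def NN (C : CNN m) {p q : ℝ≥0∞} (u : Lp ℝ p C.inRect.vol) (w : C.Weights q)
    (b : Fin (m + 1) → ℝ) : Lp ℝ ∞ C.outRect.vol :=
  toLinf C.outRect (C.fsNet (fun l => w l) b u)

/-- The output of the approximated network in `L^∞`. -/
def NNh (C : CNN m) (h : ℝ) {p q : ℝ≥0∞} (u : Lp ℝ p C.inRect.vol) (w : C.Weights q)
    (b : Fin (m + 1) → ℝ) : Lp ℝ ∞ C.outRect.vol :=
  toLinf C.outRect (C.approxNet h (fun l => w l) b u)

/-- The objective functional of the training problem in function space.  Here `nrm` is a norm on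
the space of biases. -/
def objective (C : CNN m) {p q : ℝ≥0∞} [Fact (1 ≤ q)] {Y : Type*} [NormedAddCommGroup Y]
    [NormedSpace ℝ Y] {N : ℕ} (A : Lp ℝ ∞ C.outRect.vol →L[ℝ] Y) (loss : Y → Y → ℝ≥0∞)
    (lam ν : ℝ) (nrm : Seminorm ℝ (Fin (m + 1) → ℝ)) (y : Fin N → Y)
    (u : Fin N → Lp ℝ p C.inRect.vol) (x : C.Params q) : ℝ≥0∞ :=
  ∑ j, loss (y j) (A (C.NN (u j) x.1 x.2)) + ENNReal.ofReal (lam * ‖x.1‖ + ν * nrm x.2)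

open Classical in
/-- The objective functional of the discretized training problem; it is infinite unless the
kernels are piecewise constant. -/
def objectiveH (C : CNN m) (h : ℝ) {p q : ℝ≥0∞} [Fact (1 ≤ q)] {Y : Type*}
    [NormedAddCommGroup Y] [NormedSpace ℝ Y] {N : ℕ} (A : Lp ℝ ∞ C.outRect.vol →L[ℝ] Y)
    (loss : Y → Y → ℝ≥0∞) (lam ν : ℝ) (nrm : Seminorm ℝ (Fin (m + 1) → ℝ)) (y : Fin N → Y)
    (u : Fin N → Lp ℝ p C.inRect.vol) (x : C.Params q) : ℝ≥0∞ :=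
  ∑ j, loss (y j) (A (C.NNh h (u j) x.1 x.2)) + ENNReal.ofReal (lam * ‖x.1‖ + ν * nrm x.2)
    + (if x.1 ∈ C.discreteWeights q h then 0 else ∞)

end CNN

/-- `x` is a global minimizer of `F`. -/
def IsGlobalMin {X : Type*} (F : X → ℝ≥0∞) (x : X) : Prop := ∀ z, F x ≤ F z

/-- `F` is not identically infinite. -/
def IsProperFun {X : Type*} (F : X → ℝ≥0∞) : Prop := ∃ x, F x ≠ ∞

/-- Weak convergence of a sequence in a normed space. -/
def WeaklyTendsto {X : Type*} [NormedAddCommGroup X] [NormedSpace ℝ X] (x : ℕ → X) (z : X) :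
    Prop :=
  ∀ φ : X →L[ℝ] ℝ, Tendsto (fun n => φ (x n)) atTop (𝓝 (φ z))

/-- `z` is a weak accumulation point of the sequence `x`: the weak limit of a subsequence. -/
def IsWeakAccPt {X : Type*} [NormedAddCommGroup X] [NormedSpace ℝ X] (x : ℕ → X) (z : X) :
    Prop :=
  ∃ k : ℕ → ℕ, StrictMono k ∧ WeaklyTendsto (x ∘ k) z

/-! ### The outputs of the networks are essentially bounded -/

theorem fold_mem {a b : ℝ} (hab : a < b) (x : ℝ) : fold a b x ∈ Set.Icc a b := by
  have hw : 0 < 2 * (b - a) := by linarith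
  have h1 := abs_sub_round ((x - a) / (2 * (b - a)))
  have h2 : |(x - a) - 2 * (b - a) * (round ((x - a) / (2 * (b - a))) : ℤ)| ≤ b - a := by
    have : (x - a) - 2 * (b - a) * (round ((x - a) / (2 * (b - a))) : ℤ)
        = 2 * (b - a) * ((x - a) / (2 * (b - a)) - (round ((x - a) / (2 * (b - a))) : ℤ)) := by
      rw [mul_sub (2 * (b - a)) ((x - a) / _), mul_div_cancel₀ _ hw.ne']
    rw [this, abs_mul, abs_of_pos hw]
    nlinarith
  refine ⟨?_, ?_⟩
  · have := abs_nonneg ((x - a) - 2 * (b - a) * (round ((x - a) / (2 * (b - a))) : ℤ))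
    unfold fold; linarith
  · unfold fold; linarith

theorem measurable_fold (a b : ℝ) : Measurable (fold a b) := by
  unfold fold
  simp only [round_eq]
  fun_prop

theorem map_fold_le {a b : ℝ} (hab : a < b) (R : ℝ) :
    ∃ c : ℝ≥0∞, c ≠ ∞ ∧ (volume.restrict (Set.Icc (-R) R)).map (fold a b)
      ≤ c • (volume.restrict (Set.Ioo a b)) := by
  have hw : 0 < 2 * (b - a) := by linarith
  obtain ⟨K, hK⟩ : ∃ K : ℤ, ∀ x ∈ Set.Icc (-R) R,
      round ((x - a) / (2 * (b - a))) ∈ Finset.Icc (-K) K := by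
    refine ⟨⌈(|R| + |a|) / (2 * (b - a)) + 1⌉, fun x hx => ?_⟩
    set t := (x - a) / (2 * (b - a)) with ht
    have h1 := abs_le.1 (abs_sub_round t)
    have h3 : |t| ≤ (|R| + |a|) / (2 * (b - a)) := by
      rw [ht, abs_div, abs_of_pos hw]
      have h0 : |x| ≤ |R| := (abs_le.2 hx).trans (le_abs_self R)
      have h2 := abs_sub x a
      gcongr
      linarith
    have h4 := abs_le.1 h3
    have h5 := Int.le_ceil ((|R| + |a|) / (2 * (b - a)) + 1)
    rw [Finset.mem_Icc]
    constructor
    · have : ((-⌈(|R| + |a|) / (2 * (b - a)) + 1⌉ : ℤ) : ℝ) ≤ (round t : ℤ) := by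
        push_cast; linarith
      exact_mod_cast this
    · have : ((round t : ℤ) : ℝ) ≤ ((⌈(|R| + |a|) / (2 * (b - a)) + 1⌉ : ℤ) : ℝ) := by
        linarith
      exact_mod_cast this
  refine ⟨∑ k ∈ Finset.Icc (-K) K, 2, by simp [ENNReal.mul_eq_top], ?_⟩
  refine Measure.le_iff.2 fun s hs => ?_
  rw [Measure.map_apply (measurable_fold a b) hs,
    Measure.restrict_apply (measurable_fold a b hs), Measure.smul_apply,
    Measure.restrict_congr_set (Ioo_ae_eq_Icc (a := a) (b := b)),
    Measure.restrict_apply hs, smul_eq_mul, Finset.sum_mul]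
  set T := s ∩ Set.Icc a b
  have hsub : fold a b ⁻¹' s ∩ Set.Icc (-R) R ⊆ ⋃ k ∈ Finset.Icc (-K) K,
      (((fun x => x + (-(2 * (b - a) * (k : ℝ)))) ⁻¹' T) ∪
        ((fun x => (2 * a + 2 * (b - a) * (k : ℝ)) - x) ⁻¹' T)) := by
    rintro x ⟨hx, hxR⟩
    have hT : fold a b x ∈ T := ⟨hx, fold_mem hab x⟩
    refine Set.mem_biUnion (hK x hxR) ?_
    rcases abs_cases ((x - a) - 2 * (b - a) * (round ((x - a) / (2 * (b - a))) : ℤ))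
      with ⟨h, -⟩ | ⟨h, -⟩
    · left
      have : fold a b x = x + (-(2 * (b - a) * (round ((x - a) / (2 * (b - a))) : ℤ))) := by
        unfold fold; rw [h]; ring
      rwa [this] at hT
    · right
      have : fold a b x = (2 * a + 2 * (b - a) * (round ((x - a) / (2 * (b - a))) : ℤ)) - x := by
        unfold fold; rw [h]; ring
      rwa [this] at hT
  refine (measure_mono hsub).trans ((measure_biUnion_finset_le _ _).trans ?_)
  refine Finset.sum_le_sum fun k _ => (measure_union_le _ _).trans ?_
  rw [measure_preimage_add_right, (Measure.measurePreserving_sub_left volume _).measure_preimage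
    (hs.inter measurableSet_Icc).nullMeasurableSet, two_mul]

theorem memLp_reflExt (θ : Rect) {p : ℝ≥0∞} {u : ℝ × ℝ → ℝ} (hu : MemLp u p θ.vol) (R : ℝ) :
    MemLp (reflExt θ u) p
      (volume.restrict (Set.Icc (-R) R ×ˢ Set.Icc (-R) R)) := by
  obtain ⟨c₁, hc₁, h₁⟩ := map_fold_le θ.hab R
  obtain ⟨c₂, hc₂, h₂⟩ := map_fold_le θ.hcd R
  have hm : Measurable (Prod.map (fold θ.a θ.b) (fold θ.c θ.d)) :=
    (measurable_fold _ _).prodMap (measurable_fold _ _)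
  have hle : (volume.restrict (Set.Icc (-R) R ×ˢ Set.Icc (-R) R)).map
      (Prod.map (fold θ.a θ.b) (fold θ.c θ.d)) ≤ (c₁ * c₂) • θ.vol := by
    rw [Measure.volume_eq_prod, ← Measure.prod_restrict,
      ← Measure.map_prod_map _ _ (measurable_fold _ _) (measurable_fold _ _)]
    refine (Measure.prod_mono h₁ h₂).trans (le_of_eq ?_)
    rw [Rect.vol, Rect.toSet, Measure.volume_eq_prod, ← Measure.prod_restrict,
      Measure.prod_smul_left, Measure.prod_smul_right, smul_smul]
  have h := hu.of_measure_le_smul (ENNReal.mul_ne_top hc₁ hc₂) hle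
  exact (memLp_map_measure_iff h.1 hm.aemeasurable).1 h

theorem exists_box (θ S : Rect) : ∃ R : ℝ, ∀ x ∈ θ.toSet, ∀ y ∈ S.toSet,
    x - y ∈ Set.Icc (-R) R ×ˢ Set.Icc (-R) R := by
  refine ⟨|θ.a| + |θ.b| + |θ.c| + |θ.d| + (|S.a| + |S.b| + |S.c| + |S.d|), ?_⟩
  rintro ⟨x₁, x₂⟩ ⟨⟨h1, h2⟩, ⟨h3, h4⟩⟩ ⟨y₁, y₂⟩ ⟨⟨h5, h6⟩, ⟨h7, h8⟩⟩
  simp only [] at h1 h2 h3 h4 h5 h6 h7 h8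
  have := neg_abs_le θ.a
  have := le_abs_self θ.b
  have := neg_abs_le θ.c
  have := le_abs_self θ.d
  have := neg_abs_le S.a
  have := le_abs_self S.b
  have := neg_abs_le S.c
  have := le_abs_self S.d
  have := abs_nonneg θ.a
  have := abs_nonneg θ.b
  have := abs_nonneg θ.c
  have := abs_nonneg θ.d
  have := abs_nonneg S.a
  have := abs_nonneg S.b
  have := abs_nonneg S.c
  have := abs_nonneg S.d
  refine ⟨⟨?_, ?_⟩, ⟨?_, ?_⟩⟩ <;> simp only [Prod.mk_sub_mk] <;> linarith

theorem Rect.measurableSet (θ : Rect) : MeasurableSet θ.toSet :=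
  measurableSet_Ioo.prod measurableSet_Ioo

instance (θ : Rect) : IsFiniteMeasure θ.vol := by
  refine ⟨?_⟩
  rw [Measure.restrict_apply_univ, Rect.toSet, Measure.volume_eq_prod, Measure.prod_prod,
    Real.volume_Ioo, Real.volume_Ioo]
  exact ENNReal.mul_lt_top ENNReal.ofReal_lt_top ENNReal.ofReal_lt_top

theorem memLp_rectConv (Ω' θ S : Rect) {p q : ℝ≥0∞} (hpq : p.HolderConjugate q)
    {u w : ℝ × ℝ → ℝ} (hu : MemLp u p θ.vol) (hw : MemLp w q S.vol) :
    MemLp (rectConv S (reflExt θ u) w) ∞ Ω'.vol := by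
  obtain ⟨R, hR⟩ := exists_box Ω' S
  set B : Set (ℝ × ℝ) := Set.Icc (-R) R ×ˢ Set.Icc (-R) R
  have hB : MeasurableSet B := measurableSet_Icc.prod measurableSet_Icc
  obtain ⟨V, hVdef⟩ : ∃ V : ℝ × ℝ → ℝ, V = B.indicator (reflExt θ u) := ⟨_, rfl⟩
  have hV : MemLp V p volume := hVdef ▸ (memLp_indicator_iff_restrict hB).2 (memLp_reflExt θ hu R)
  have heq : ∀ x ∈ Ω'.toSet, rectConv S (reflExt θ u) w x = ∫ y, w y * V (x - y) ∂S.vol := by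
    intro x hx
    refine setIntegral_congr_fun S.measurableSet fun y hy => ?_
    rw [hVdef, Set.indicator_of_mem (hR x hx y hy)]
  have hsm : AEStronglyMeasurable (fun x => ∫ y, w y * V (x - y) ∂S.vol) volume :=
    (hw.1.convolution_integrand (ContinuousLinearMap.mul ℝ ℝ) hV.1).integral_prod_right'
  have hae : (fun x => ∫ y, w y * V (x - y) ∂S.vol) =ᵐ[Ω'.vol] rectConv S (reflExt θ u) w := by
    filter_upwards [ae_restrict_mem Ω'.measurableSet] with x hx using (heq x hx).symm
  refine MemLp.ae_eq hae (memLp_top_of_bound hsm.restrict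
    (ENNReal.toReal (eLpNorm w q S.vol * eLpNorm V p volume)) (Eventually.of_forall fun x => ?_))
  have hfin : eLpNorm w q S.vol * eLpNorm V p volume ≠ ∞ := ENNReal.mul_ne_top hw.2.ne hV.2.ne
  have hmp : MeasurePreserving (fun y : ℝ × ℝ => x - y) volume volume :=
    Measure.measurePreserving_sub_left volume x
  have hVx : MemLp (fun y => V (x - y)) p volume := hV.comp_measurePreserving hmp
  have hnorm : eLpNorm (fun y => V (x - y)) p volume = eLpNorm V p volume :=
    eLpNorm_comp_measurePreserving hV.1 hmp
  have := hpq.symm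
  have h1 : eLpNorm (fun y => w y * V (x - y)) 1 S.vol
      ≤ eLpNorm w q S.vol * eLpNorm V p volume := by
    have h2 : eLpNorm (w • fun y => V (x - y)) 1 S.vol
        ≤ eLpNorm w q S.vol * eLpNorm (fun y => V (x - y)) p S.vol :=
      eLpNorm_smul_le_mul_eLpNorm hVx.1.restrict hw.1
    have h3 : eLpNorm (fun y => V (x - y)) p S.vol ≤ eLpNorm V p volume :=
      (eLpNorm_mono_measure _ Measure.restrict_le_self).trans hnorm.le
    exact h2.trans (mul_le_mul_right h3 _)
  rw [← ENNReal.ofReal_le_iff_le_toReal hfin, ofReal_norm]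
  refine (enorm_integral_le_lintegral_enorm _).trans ?_
  rwa [← eLpNorm_one_eq_lintegral_enorm]

theorem memLp_stepFun (θ θ' : Rect) (h : ℝ) (U : ℕ → ℕ → ℝ) :
    MemLp (stepFun θ h U) ∞ θ'.vol := by
  have hfin : ∀ a b e : ℝ, ((fun t : ℝ => ⌊(t - a) / h⌋₊) '' Set.Ioo b e).Finite := by
    intro a b e
    refine (Set.finite_Iic ⌊(|a| + |b| + |e|) / |h|⌋₊).subset ?_
    rintro _ ⟨t, ht, rfl⟩
    refine Nat.floor_mono ((le_abs_self _).trans ?_)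
    rw [abs_div]
    gcongr
    rw [abs_le]
    constructor <;> linarith [ht.1, ht.2, neg_abs_le a, neg_abs_le b, neg_abs_le e,
      le_abs_self a, le_abs_self b, le_abs_self e, abs_nonneg a, abs_nonneg b, abs_nonneg e]
  obtain ⟨c, hc⟩ := (((hfin θ.a θ'.a θ'.b).prod (hfin θ.c θ'.c θ'.d)).image
    fun k : ℕ × ℕ => ‖U k.1 k.2‖).bddAbove
  refine memLp_top_of_bound ?_ c ?_
  · refine Measurable.aestronglyMeasurable ?_
    have hU : Measurable fun k : ℕ × ℕ => U k.1 k.2 := measurable_of_countable _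
    exact hU.comp ((Nat.measurable_floor.comp ((measurable_fst.sub_const _).div_const _)).prodMk
      (Nat.measurable_floor.comp ((measurable_snd.sub_const _).div_const _)))
  · filter_upwards [ae_restrict_mem θ'.measurableSet] with x hx
    exact hc ⟨(_, _), ⟨⟨x.1, hx.1, rfl⟩, ⟨x.2, hx.2, rfl⟩⟩, rfl⟩

namespace CNN

variable {m : ℕ}

theorem memLp_fsNet (C : CNN m) (hact : ∃ K : ℝ≥0, LipschitzWith K C.act)
    {p q : ℝ≥0∞} (hpq : p.HolderConjugate q) {u : ℝ × ℝ → ℝ} (hu : MemLp u p C.inRect.vol)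
    {w : Fin (m + 1) → ℝ × ℝ → ℝ} (hw : ∀ l, MemLp (w l) q (C.S l).vol)
    (b : Fin (m + 1) → ℝ) : MemLp (C.fsNet w b u) ∞ C.outRect.vol := by
  have haff : ∀ (l : Fin (m + 1)) (v : ℝ × ℝ → ℝ), MemLp v p (C.Ω l.castSucc).vol →
      MemLp (C.affine l (w l) (b l) v) ∞ (C.Ω l.succ).vol := fun l v hv =>
    (memLp_rectConv _ _ _ hpq hv (hw l)).add (memLp_const _)
  obtain ⟨K, hK⟩ := hact
  have hin : ∀ (l : ℕ) (hl : l < m + 1),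
      MemLp (C.layerIn w b u l hl) p (C.Ω (Fin.castSucc ⟨l, hl⟩)).vol := by
    intro l
    induction l with
    | zero => intro _; exact hu
    | succ l ih =>
      intro hl
      have h1 := haff ⟨l, by omega⟩ _ (ih (by omega))
      have h2 : MemLp (fun x => C.act (C.affine ⟨l, by omega⟩ (w ⟨l, by omega⟩) (b ⟨l, by omega⟩)
          (C.layerIn w b u l (by omega)) x) - C.act 0) ∞
          (C.Ω (Fin.succ ⟨l, by omega⟩)).vol := by
        refine h1.of_le_mul (c := K) ?_ (Eventually.of_forall fun x => ?_)
        · exact (hK.continuous.comp_aestronglyMeasurable h1.1).sub aestronglyMeasurable_const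
        · have := hK.dist_le_mul (C.affine ⟨l, by omega⟩ (w ⟨l, by omega⟩) (b ⟨l, by omega⟩)
            (C.layerIn w b u l (by omega)) x) 0
          simpa [dist_eq_norm] using this
      have h3 := (h2.add (memLp_const (C.act 0))).mono_exponent (p := p) le_top
      refine h3.ae_eq (Eventually.of_forall fun x => ?_)
      simp [layerIn]
  exact haff (Fin.last m) _ (hin m _)

theorem memLp_approxNet (C : CNN m) (h : ℝ) (u : ℝ × ℝ → ℝ) (w : Fin (m + 1) → ℝ × ℝ → ℝ)
    (b : Fin (m + 1) → ℝ) : MemLp (C.approxNet h w b u) ∞ C.outRect.vol := by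
  unfold approxNet downsample
  exact memLp_stepFun _ _ _ _

/-- The output `NN` in `L^∞` is the class of the function `fsNet`. -/
theorem coeFn_NN (C : CNN m) (hact : ∃ K : ℝ≥0, LipschitzWith K C.act)
    {p q : ℝ≥0∞} (hpq : p.HolderConjugate q) (u : Lp ℝ p C.inRect.vol) (w : C.Weights q)
    (b : Fin (m + 1) → ℝ) :
    C.NN u w b =ᵐ[C.outRect.vol] C.fsNet (fun l => w l) b u := by
  have hv := C.memLp_fsNet hact hpq (Lp.memLp u) (fun l => Lp.memLp (w l)) b
  unfold NN toLinf
  rw [dif_pos hv]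
  exact hv.coeFn_toLp

/-- The output `NNh` in `L^∞` is the class of the function `approxNet`. -/
theorem coeFn_NNh (C : CNN m) (h : ℝ) {p q : ℝ≥0∞} (u : Lp ℝ p C.inRect.vol)
    (w : C.Weights q) (b : Fin (m + 1) → ℝ) :
    C.NNh h u w b =ᵐ[C.outRect.vol] C.approxNet h (fun l => w l) b u := by
  have hv := C.memLp_approxNet h u (fun l => w l) b
  unfold NNh toLinf
  rw [dif_pos hv]
  exact hv.coeFn_toLp

end CNN

end

/-!
The theorem is an instance of variational convergence: the discretized objective functionals
converge to the objective functional with respect to the weak topology of the parameter space, and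
they are equicoercive because of the regularizer.

The analytic core is that convolution turns weak convergence of the kernels into uniform
convergence. If `u n → u` strongly in `L^p` and `w n ⇀ w` weakly in `L^q`, then
`∫ w n (y) u n (x - y) dy` converges jointly in `n` and `x`, because `x ↦ u (x - ·)` is continuous
with values in `L^p` and the pairing of a strongly with a weakly convergent sequence converges
(`tendsto_rectConv`). This continuous convergence survives the activation function and the
sampling operators: the value at `x` of the projected, downsampled and upsampled function lies
between bounds for the original function on a neighbourhood of `x` whose size is proportional to
the resolution (`stepFun_refined_bounds`,
`tendsto_of_local_bounds`). On bounded domains it implies uniform convergence, hence convergence in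
`L^p`, so an induction over the layers gives `NNh → NN` in `L^∞` (`CNN.tendsto_NNh`). For a fixed
resolution the same argument works with pointwise convergence on the finitely many cells
(`CNN.tendsto_NNh_of_res`).

Weak compactness of bounded sets of parameters comes from the Riesz representation of the dual
space of `L^p` (`exists_lpDual_eq`), proved with the Radon-Nikodym theorem, and from the sequential
Banach-Alaoglu theorem (`exists_subseq_weaklyTendsto_Lp`). The discretized problems have minimizers
by the direct method (`exists_isGlobalMin`), since piecewise constant kernels form a weakly closed
set. Recovery sequences exist because piecewise constant functions are dense in `L^q` as the
resolution tends to zero (`exists_isPC_tendsto`). The dichotomy for the minimal values and the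
statement on accumulation points then follow from `tendsto_minimizers`.
-/

noncomputable section

/-! ### Weak convergence -/

namespace WeaklyTendsto

variable {X X' : Type*} [NormedAddCommGroup X] [NormedSpace ℝ X] [NormedAddCommGroup X']
  [NormedSpace ℝ X'] {x : ℕ → X} {z : X}

theorem map (hx : WeaklyTendsto x z) (T : X →L[ℝ] X') :
    WeaklyTendsto (fun n => T (x n)) (T z) :=
  fun φ => hx (φ.comp T)

theorem comp_tendsto (hx : WeaklyTendsto x z) {k : ℕ → ℕ} (hk : Tendsto k atTop atTop) :
    WeaklyTendsto (x ∘ k) z :=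
  fun φ => (hx φ).comp hk

theorem of_tendsto (hx : Tendsto x atTop (𝓝 z)) : WeaklyTendsto x z :=
  fun φ => (φ.continuous.tendsto z).comp hx

/-- Uniform boundedness principle, for the sequence of evaluations on the dual space. -/
theorem exists_norm_le (hx : WeaklyTendsto x z) : ∃ M : ℝ, ∀ n, ‖x n‖ ≤ M := by
  obtain ⟨M, hM⟩ := banach_steinhaus (g := fun n => NormedSpace.inclusionInDoubleDual ℝ X (x n))
    (fun φ => by
      obtain ⟨c, hc⟩ := (hx φ).norm.bddAbove_range
      exact ⟨c, fun n => by
        rw [NormedSpace.dual_def]; exact hc ⟨n, rfl⟩⟩)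
  exact ⟨M, fun n => ((NormedSpace.inclusionInDoubleDualLi ℝ (E := X)).norm_map (x n)).symm.le.trans
    (hM n)⟩

/-- A weakly convergent sequence in a finite-dimensional product of lines converges. -/
theorem tendsto_pi {ι : Type*} [Fintype ι] {b : ℕ → ι → ℝ} {β : ι → ℝ}
    (hb : WeaklyTendsto b β) : Tendsto b atTop (𝓝 β) :=
  tendsto_pi_nhds.2 fun i => hb (ContinuousLinearMap.proj i)

end WeaklyTendsto

/-! ### The dual space of `L^p` -/

section Riesz

variable {α : Type*} [MeasurableSpace α] {μ : Measure α}
  {p q : ℝ≥0∞} [Fact (1 ≤ p)] [Fact (1 ≤ q)]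

/-- The pairing `(f, g) ↦ ∫ f g` of `L^p` and `L^q`. -/
def lpDual (μ : Measure α) (p q : ℝ≥0∞) [Fact (1 ≤ p)] [Fact (1 ≤ q)] [p.HolderConjugate q] :
    Lp ℝ p μ →L[ℝ] Lp ℝ q μ →L[ℝ] ℝ :=
  (ContinuousLinearMap.mul ℝ ℝ).lpPairing μ p q

theorem lpDual_apply [p.HolderConjugate q] (f : Lp ℝ p μ) (g : Lp ℝ q μ) :
    lpDual μ p q f g = ∫ x, f x * g x ∂μ :=
  (ContinuousLinearMap.mul ℝ ℝ).lpPairing_eq_integral f g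

variable [IsFiniteMeasure μ]

/-- The signed measure `s ↦ φ 1ₛ` of a functional `φ` on `L^p`. -/
def dualSignedMeasure (hp : p ≠ ∞) (φ : Lp ℝ p μ →L[ℝ] ℝ) : SignedMeasure α := by
  classical
  exact
  { measureOf' := fun s =>
      if hs : MeasurableSet s then φ (indicatorConstLp p hs (measure_ne_top μ s) 1) else 0
    empty' := by simp
    not_measurable' := fun s hs => by simp [hs]
    m_iUnion' := fun A hA hd => by
      have hfin : ∀ F : Finset ℕ, MeasurableSet (⋃ i ∈ F, A i) := fun F =>
        F.measurableSet_biUnion fun i _ => hA i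
      have hsum : ∀ F : Finset ℕ, ∑ i ∈ F, indicatorConstLp p (hA i) (measure_ne_top μ (A i)) (1 : ℝ)
          = indicatorConstLp p (hfin F) (measure_ne_top μ _) 1 := by
        intro F
        induction F using Finset.induction_on with
        | empty => simp
        | insert a F ha ih =>
          have hdis : Disjoint (A a) (⋃ i ∈ F, A i) := by
            rw [Set.disjoint_iUnion₂_right]
            exact fun i hi => hd (fun h => ha (h ▸ hi))
          rw [Finset.sum_insert ha, ih, ← indicatorConstLp_disjoint_union (hA a) (hfin F)
            (measure_ne_top μ _) (measure_ne_top μ _) hdis]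
          congr 1
          simp
      have hU := MeasurableSet.iUnion hA
      have hlim : Tendsto (fun F : Finset ℕ => μ (symmDiff (⋃ i ∈ F, A i) (⋃ i, A i))) atTop (𝓝 0) := by
        have h1 : ∀ F : Finset ℕ, μ (symmDiff (⋃ i ∈ F, A i) (⋃ i, A i))
            = μ (⋃ i, A i) - ∑ i ∈ F, μ (A i) := by
          intro F
          have hsub : (⋃ i ∈ F, A i) ⊆ ⋃ i, A i := Set.iUnion₂_subset_iUnion _ _
          rw [symmDiff_of_le (by exact hsub), ← measure_biUnion_finset
            (fun i _ j _ hij => hd hij) (fun i _ => hA i), measure_sdiff hsub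
            (hfin F).nullMeasurableSet (measure_ne_top μ _)]
        simp_rw [h1]
        have h2 : Tendsto (fun F : Finset ℕ => ∑ i ∈ F, μ (A i)) atTop (𝓝 (μ (⋃ i, A i))) := by
          rw [measure_iUnion hd hA]
          exact ENNReal.summable.hasSum
        have h3 := ENNReal.Tendsto.sub (tendsto_const_nhds (x := μ (⋃ i, A i))) h2
          (Or.inl (measure_ne_top μ _))
        rwa [tsub_self] at h3
      have h4 := (φ.continuous.tendsto _).comp (tendsto_indicatorConstLp_set (c := (1 : ℝ)) (p := p)
        (ht := hfin) (hμt := fun F => measure_ne_top μ _) (hs := hU) (hμs := measure_ne_top μ _)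
        hp hlim)
      simp only [hA, hU, dif_pos]
      refine h4.congr fun F => ?_
      simp [← hsum, map_sum] }

theorem dualSignedMeasure_apply (hp : p ≠ ∞) (φ : Lp ℝ p μ →L[ℝ] ℝ) {s : Set α}
    (hs : MeasurableSet s) :
    dualSignedMeasure hp φ s = φ (indicatorConstLp p hs (measure_ne_top μ s) 1) := by
  classical
  change (if hs : MeasurableSet s then _ else _) = _
  rw [dif_pos hs]

/-- Two functionals on `L^p` that agree on indicator functions are equal. -/
theorem dual_ext_indicator (hp : p ≠ ∞) {φ ψ : Lp ℝ p μ →L[ℝ] ℝ}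
    (h : ∀ s (hs : MeasurableSet s), φ (indicatorConstLp p hs (measure_ne_top μ s) 1)
      = ψ (indicatorConstLp p hs (measure_ne_top μ s) 1)) : φ = ψ := by
  ext f
  refine Lp.induction hp (motive := fun f => φ f = ψ f) ?_ ?_ ?_ f
  · intro c s hs hμs
    have : ((Lp.simpleFunc.indicatorConst p hs hμs.ne c : Lp.simpleFunc ℝ p μ) : Lp ℝ p μ)
        = c • indicatorConstLp p hs (measure_ne_top μ s) (1 : ℝ) := by
      rw [Lp.simpleFunc.coe_indicatorConst]
      unfold indicatorConstLp
      rw [← MemLp.toLp_const_smul]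
      congr 1
      ext x
      by_cases hx : x ∈ s <;> simp [hx]
    rw [this, map_smul, map_smul, h s hs]
  · intro f g hf hg _ h1 h2
    rw [map_add, map_add, h1, h2]
  · exact isClosed_eq φ.continuous ψ.continuous

omit [IsFiniteMeasure μ] in
/-- The converse of Hölder's inequality. -/
theorem norm_le_of_lpDual_le [p.HolderConjugate q] (hp : p ≠ ∞) (hq : q ≠ ∞)
    (g : Lp ℝ q μ) {c : ℝ} (hc0 : 0 ≤ c) (hc : ∀ f : Lp ℝ p μ, |lpDual μ p q f g| ≤ c * ‖f‖) :
    ‖g‖ ≤ c := by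
  have hp0 : p ≠ 0 := (one_pos.trans_le (Fact.out : 1 ≤ p)).ne'
  have hq0 : q ≠ 0 := (one_pos.trans_le (Fact.out : 1 ≤ q)).ne'
  have hPQ := ENNReal.HolderConjugate.toReal_of_ne_top hp hq
  obtain ⟨P, hP⟩ : ∃ P, P = p.toReal := ⟨_, rfl⟩
  obtain ⟨Q, hQ⟩ : ∃ Q, Q = q.toReal := ⟨_, rfl⟩
  rw [← hP, ← hQ] at hPQ
  -- The extremal function of Hölder's inequality is `sign g * |g| ^ (Q - 1)`.
  obtain ⟨F, hF⟩ : ∃ F : ℝ → ℝ, F = fun t => t * |t| ^ (Q - 2) := ⟨_, rfl⟩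
  have hFm : Measurable F := by rw [hF]; fun_prop
  have hFabs : ∀ t, |F t| ^ P = |t| ^ Q := by
    intro t
    rcases eq_or_ne t 0 with rfl | ht
    · simp [hF, Real.zero_rpow hPQ.ne_zero, Real.zero_rpow hPQ.symm.ne_zero]
    · have h0 : 0 < |t| := abs_pos.2 ht
      have h1 : |F t| = |t| ^ (Q - 1) := by
        rw [hF]
        simp only [abs_mul]
        rw [abs_of_nonneg (Real.rpow_nonneg h0.le _), ← Real.rpow_one_add' h0.le]
        · congr 1; ring
        · have := hPQ.symm.lt; intro h; linarith
      rw [h1, ← Real.rpow_mul h0.le, hPQ.symm.sub_one_mul_conj]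
  have hFt : ∀ t, F t * t = |t| ^ Q := by
    intro t
    rcases eq_or_ne t 0 with rfl | ht
    · simp [Real.zero_rpow hPQ.symm.ne_zero]
    · have h0 : 0 < |t| := abs_pos.2 ht
      calc F t * t = |t| ^ (2 : ℝ) * |t| ^ (Q - 2) := by
            rw [hF, Real.rpow_two, sq_abs]; ring
        _ = |t| ^ Q := by rw [← Real.rpow_add h0]; congr 1; ring
  have hint : Integrable (fun x => ‖g x‖ ^ Q) μ := by
    rw [hQ]; exact (Lp.memLp g).integrable_norm_rpow hq0 hq
  have hf : MemLp (fun x => F (g x)) p μ := by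
    have hm : AEStronglyMeasurable (fun x => F (g x)) μ := (hFm.comp_aemeasurable
      (Lp.aestronglyMeasurable g).aemeasurable).aestronglyMeasurable
    rw [← integrable_norm_rpow_iff hm hp0 hp, ← hP]
    exact hint.congr (Eventually.of_forall fun x => (hFabs (g x)).symm)
  obtain ⟨I, hI⟩ : ∃ I, I = ∫ x, ‖g x‖ ^ Q ∂μ := ⟨_, rfl⟩
  have hI0 : 0 ≤ I := hI ▸ integral_nonneg fun x => Real.rpow_nonneg (norm_nonneg _) _
  have hg1 : ‖g‖ = I ^ Q⁻¹ := by
    rw [Lp.norm_def, (Lp.memLp g).eLpNorm_eq_integral_rpow_norm hq0 hq, ← hQ, ← hI,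
      ENNReal.toReal_ofReal (Real.rpow_nonneg hI0 _)]
  have hf1 : ‖hf.toLp _‖ = I ^ P⁻¹ := by
    rw [Lp.norm_toLp, hf.eLpNorm_eq_integral_rpow_norm hp0 hp, ← hP,
      ENNReal.toReal_ofReal (Real.rpow_nonneg (integral_nonneg fun x =>
        Real.rpow_nonneg (norm_nonneg _) _) _), hI]
    congr 1
    exact integral_congr_ae (Eventually.of_forall fun x => hFabs (g x))
  have hpair : lpDual μ p q (hf.toLp _) g = I := by
    rw [lpDual_apply, hI]
    refine integral_congr_ae ?_
    filter_upwards [hf.coeFn_toLp] with x hx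
    rw [hx, hFt]; rfl
  have hle := hc (hf.toLp _)
  rw [hpair, hf1, abs_of_nonneg hI0] at hle
  rcases hI0.eq_or_lt with h | h
  · rw [hg1, ← h, Real.zero_rpow (inv_ne_zero hPQ.symm.ne_zero)]; exact hc0
  · rw [hg1]
    have h2 : I = I ^ Q⁻¹ * I ^ P⁻¹ := by
      rw [← Real.rpow_add h, add_comm, hPQ.inv_add_inv_eq_one, Real.rpow_one]
    rw [h2] at hle
    have h3 : 0 < I ^ P⁻¹ := Real.rpow_pos_of_pos h _
    refine le_of_mul_le_mul_right (hle.trans (le_of_eq ?_)) h3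
    rw [← h2]

theorem lpDual_indicatorConstLp (p : ℝ≥0∞) [Fact (1 ≤ p)] [p.HolderConjugate q] {s : Set α}
    (hs : MeasurableSet s) (g : Lp ℝ q μ) :
    lpDual μ p q (indicatorConstLp p hs (measure_ne_top μ s) 1) g = ∫ x in s, g x ∂μ := by
  rw [lpDual_apply, ← integral_indicator hs]
  refine integral_congr_ae ?_
  filter_upwards [indicatorConstLp_coeFn (p := p) (hs := hs) (hμs := measure_ne_top μ s)
    (c := (1 : ℝ))] with x hx
  rw [hx]
  by_cases h : x ∈ s <;> simp [h]

/-- The Riesz representation theorem: every functional on `L^p` of a finite measure is given by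
a function in `L^q`. -/
theorem exists_lpDual_eq [p.HolderConjugate q] (hp : p ≠ ∞) (hq : q ≠ ∞)
    (φ : Lp ℝ p μ →L[ℝ] ℝ) : ∃ g : Lp ℝ q μ, ∀ f, φ f = lpDual μ p q f g := by
  have hac : dualSignedMeasure hp φ ≪ᵥ μ.toENNRealVectorMeasure := by
    refine VectorMeasure.AbsolutelyContinuous.mk fun s hs h0 => ?_
    rw [Measure.toENNRealVectorMeasure_apply_measurable hs] at h0
    rw [dualSignedMeasure_apply hp φ hs]
    have : indicatorConstLp p hs (measure_ne_top μ s) (1 : ℝ) = 0 := by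
      rw [← norm_le_zero_iff]
      refine norm_indicatorConstLp_le.trans ?_
      rw [measureReal_def, h0]
      have hp0 : p ≠ 0 := (one_pos.trans_le (Fact.out : 1 ≤ p)).ne'
      simp [Real.zero_rpow (inv_ne_zero (ENNReal.toReal_pos hp0 hp).ne')]
    rw [this, map_zero]
  obtain ⟨G, hG⟩ : ∃ G, G = (dualSignedMeasure hp φ).rnDeriv μ := ⟨_, rfl⟩
  have hGi : Integrable G μ := hG ▸ SignedMeasure.integrable_rnDeriv _ _
  have hGm : Measurable G := hG ▸ SignedMeasure.measurable_rnDeriv _ _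
  have hGs : ∀ s (hs : MeasurableSet s),
      φ (indicatorConstLp p hs (measure_ne_top μ s) 1) = ∫ x in s, G x ∂μ := by
    intro s hs
    rw [← dualSignedMeasure_apply hp φ hs, ← withDensityᵥ_apply hGi hs, hG,
      SignedMeasure.withDensityᵥ_rnDeriv_eq _ _ hac]
  have hpair := fun s (hs : MeasurableSet s) (g : Lp ℝ q μ) => lpDual_indicatorConstLp p hs g
  -- The truncations of the density are bounded in `L^q` by `‖φ‖`.
  have hT : ∀ n : ℕ, MeasurableSet {x | |G x| ≤ n} := fun n =>
    measurableSet_le hGm.abs measurable_const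
  have hgn : ∀ n : ℕ, MemLp ({x | |G x| ≤ n}.indicator G) q μ := fun n =>
    (memLp_top_of_bound (hGm.indicator (hT n)).aestronglyMeasurable n
      (Eventually.of_forall fun x => by
        by_cases h : |G x| ≤ n <;> simp [h])).mono_exponent le_top
  have hbound : ∀ n : ℕ, eLpNorm ({x | |G x| ≤ n}.indicator G) q μ ≤ ENNReal.ofReal ‖φ‖ := by
    intro n
    let χ : Lp ℝ ∞ μ := indicatorConstLp ∞ (hT n) (measure_ne_top μ _) 1
    let T : Lp ℝ p μ →L[ℝ] Lp ℝ p μ := (ContinuousLinearMap.mul ℝ ℝ).holderL μ ∞ p p χ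
    have hTf : ∀ f, T f =ᵐ[μ] fun x => χ x * f x := fun f =>
      (ContinuousLinearMap.mul ℝ ℝ).coeFn_holder χ f
    have hχ : χ =ᵐ[μ] {x | |G x| ≤ n}.indicator fun _ => 1 := indicatorConstLp_coeFn
    have heq : φ.comp T = (lpDual μ p q).flip ((hgn n).toLp _) := by
      refine dual_ext_indicator hp fun s hs => ?_
      rw [ContinuousLinearMap.flip_apply, hpair, ContinuousLinearMap.comp_apply]
      have h1 : T (indicatorConstLp p hs (measure_ne_top μ s) 1)
          = indicatorConstLp p (hs.inter (hT n)) (measure_ne_top μ _) 1 := by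
        ext1
        filter_upwards [hTf (indicatorConstLp p hs (measure_ne_top μ s) 1), hχ,
          indicatorConstLp_coeFn (p := p) (hs := hs) (hμs := measure_ne_top μ s) (c := (1 : ℝ)),
          indicatorConstLp_coeFn (p := p) (hs := hs.inter (hT n)) (hμs := measure_ne_top μ _)
            (c := (1 : ℝ))] with x h1 h2 h3 h4
        rw [h1, h2, h3, h4]
        by_cases hx : x ∈ s <;> by_cases hx' : |G x| ≤ n <;> simp [hx, hx']
      rw [h1, hGs _ (hs.inter (hT n)), ← setIntegral_indicator (hT n)]
      refine setIntegral_congr_ae hs ?_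
      filter_upwards [(hgn n).coeFn_toLp] with x hx _ using hx.symm
    have hTn : ∀ f, ‖T f‖ ≤ ‖f‖ := by
      intro f
      refine Lp.norm_le_norm_of_ae_le ?_
      filter_upwards [hTf f, hχ] with x h1 h2
      rw [h1, h2]
      by_cases hx' : |G x| ≤ n <;> simp [hx']
    have h2 := norm_le_of_lpDual_le hp hq ((hgn n).toLp _) (norm_nonneg φ) (fun f => by
      rw [← ContinuousLinearMap.flip_apply, ← heq, ContinuousLinearMap.comp_apply,
        ← Real.norm_eq_abs]
      exact (φ.le_opNorm _).trans (mul_le_mul_of_nonneg_left (hTn f) (norm_nonneg _)))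
    rw [Lp.norm_toLp] at h2
    rw [← ENNReal.ofReal_toReal (hgn n).2.ne]
    exact ENNReal.ofReal_le_ofReal h2
  have hGq : MemLp G q μ := by
    refine ⟨hGm.aestronglyMeasurable, lt_of_le_of_lt ?_ (ENNReal.ofReal_lt_top (r := ‖φ‖))⟩
    refine (Lp.eLpNorm_lim_le_liminf_eLpNorm
      (fun n : ℕ => (hgn n).1) G (Eventually.of_forall fun x => ?_)).trans
      (liminf_le_of_le (by isBoundedDefault) fun b hb => ?_)
    · refine tendsto_const_nhds.congr' ?_
      filter_upwards [eventually_ge_atTop ⌈|G x|⌉₊] with n hn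
      have : |G x| ≤ n := (Nat.le_ceil _).trans (by exact_mod_cast hn)
      simp [this]
    · obtain ⟨n, hn⟩ := hb.exists
      exact hn.trans (hbound n)
  refine ⟨hGq.toLp G, fun f => ?_⟩
  rw [← ContinuousLinearMap.flip_apply]
  congr 1
  refine dual_ext_indicator hp fun s hs => ?_
  rw [ContinuousLinearMap.flip_apply, hpair, hGs s hs]
  refine setIntegral_congr_ae hs ?_
  filter_upwards [hGq.coeFn_toLp] with x hx _ using hx.symm

/-- Bounded sequences in `L^q` have weakly convergent subsequences: `L^q` is the dual space of the
separable space `L^p`, and its own dual space is `L^p` again. -/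
theorem exists_subseq_weaklyTendsto_Lp [MeasurableSpace.CountablyGenerated α]
    (hpq : p.HolderConjugate q) (hp : p ≠ ∞) (hq : q ≠ ∞)
    {w : ℕ → Lp ℝ q μ} {M : ℝ} (hw : ∀ n, ‖w n‖ ≤ M) :
    ∃ z, ∃ k : ℕ → ℕ, StrictMono k ∧ WeaklyTendsto (w ∘ k) z := by
  have := hpq.symm
  have : Fact (p ≠ ∞) := ⟨hp⟩
  let J : Lp ℝ q μ →L[ℝ] Lp ℝ p μ →L[ℝ] ℝ := (lpDual μ p q).flip
  obtain ⟨φ, -, k, hk, hlim⟩ := WeakDual.isSeqCompact_closedBall ℝ (Lp ℝ p μ) 0 (‖J‖ * M)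
    (x := fun n => StrongDual.toWeakDual (J (w n))) (fun n => by
      rw [Set.mem_preimage, mem_closedBall_zero_iff]
      exact (J.le_opNorm _).trans (mul_le_mul_of_nonneg_left (hw n) (norm_nonneg _)))
  obtain ⟨z, hz⟩ := exists_lpDual_eq (q := q) hp hq (WeakDual.toStrongDual φ)
  refine ⟨z, k, hk, fun ψ => ?_⟩
  obtain ⟨f, hf⟩ := exists_lpDual_eq (q := p) hq hp ψ
  have hsymm : ∀ v : Lp ℝ q μ, ψ v = lpDual μ p q f v := fun v => by
    rw [hf, lpDual_apply, lpDual_apply]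
    simp_rw [mul_comm]
  rw [hsymm, ← hz]
  have := ((WeakDual.eval_continuous f).tendsto φ).comp hlim
  refine this.congr fun n => ?_
  rw [Function.comp_apply, Function.comp_apply, Function.comp_apply, hsymm]
  rfl

end Riesz

/-! ### Convolution of a strongly and a weakly convergent sequence -/

theorem map_fold_restrict_le (θ : Rect) (R : ℝ) : ∃ c : ℝ≥0∞, c ≠ ∞ ∧
    (volume.restrict (Set.Icc (-R) R ×ˢ Set.Icc (-R) R)).map
      (Prod.map (fold θ.a θ.b) (fold θ.c θ.d)) ≤ c • θ.vol := by
  obtain ⟨c₁, hc₁, h₁⟩ := map_fold_le θ.hab R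
  obtain ⟨c₂, hc₂, h₂⟩ := map_fold_le θ.hcd R
  refine ⟨c₁ * c₂, ENNReal.mul_ne_top hc₁ hc₂, ?_⟩
  rw [Measure.volume_eq_prod, ← Measure.prod_restrict,
    ← Measure.map_prod_map _ _ (measurable_fold _ _) (measurable_fold _ _)]
  refine (Measure.prod_mono h₁ h₂).trans (le_of_eq ?_)
  rw [Rect.vol, Rect.toSet, Measure.volume_eq_prod, ← Measure.prod_restrict,
    Measure.prod_smul_left, Measure.prod_smul_right, smul_smul]

theorem exists_eLpNorm_reflExt_le (θ : Rect) {p : ℝ≥0∞} (hp : p ≠ ∞) (R : ℝ) :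
    ∃ c : ℝ≥0∞, c ≠ ∞ ∧ ∀ u : ℝ × ℝ → ℝ, MemLp u p θ.vol →
      eLpNorm (reflExt θ u) p (volume.restrict (Set.Icc (-R) R ×ˢ Set.Icc (-R) R))
        ≤ c * eLpNorm u p θ.vol := by
  obtain ⟨c, hc, hle⟩ := map_fold_restrict_le θ R
  have hm : Measurable (Prod.map (fold θ.a θ.b) (fold θ.c θ.d)) :=
    (measurable_fold _ _).prodMap (measurable_fold _ _)
  refine ⟨c ^ (1 / p).toReal, ENNReal.rpow_ne_top_of_nonneg ENNReal.toReal_nonneg hc,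
    fun u hu => ?_⟩
  have h := hu.of_measure_le_smul hc hle
  calc eLpNorm (u ∘ Prod.map (fold θ.a θ.b) (fold θ.c θ.d)) p _
      = eLpNorm u p _ := (eLpNorm_map_measure h.1 hm.aemeasurable).symm
    _ ≤ eLpNorm u p (c • θ.vol) := eLpNorm_mono_measure _ hle
    _ = _ := by rw [eLpNorm_smul_measure_of_ne_top hp]; simp

/-- The reflection extension of `u`, cut off outside the square `[-R, R]²`, in `L^p(ℝ²)`. -/
def cutExt (θ : Rect) (R : ℝ) {p : ℝ≥0∞} {u : ℝ × ℝ → ℝ} (hu : MemLp u p θ.vol) :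
    Lp ℝ p (volume : Measure (ℝ × ℝ)) :=
  ((memLp_indicator_iff_restrict (measurableSet_Icc.prod measurableSet_Icc)).2
    (memLp_reflExt θ hu R)).toLp
      ((Set.Icc (-R) R ×ˢ Set.Icc (-R) R).indicator (reflExt θ u))

theorem tendsto_cutExt (θ : Rect) (R : ℝ) {p : ℝ≥0∞} [Fact (1 ≤ p)] (hp : p ≠ ∞)
    {u : ℕ → ℝ × ℝ → ℝ} {v : ℝ × ℝ → ℝ} (hu : ∀ n, MemLp (u n) p θ.vol) (hv : MemLp v p θ.vol)
    (huv : Tendsto (fun n => eLpNorm (u n - v) p θ.vol) atTop (𝓝 0)) :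
    Tendsto (fun n => cutExt θ R (hu n)) atTop (𝓝 (cutExt θ R hv)) := by
  obtain ⟨c, hc, hle⟩ := exists_eLpNorm_reflExt_le θ hp R
  unfold cutExt
  rw [Lp.tendsto_Lp_iff_tendsto_eLpNorm'']
  refine tendsto_of_tendsto_of_tendsto_of_le_of_le tendsto_const_nhds
    (g := fun _ => 0) (h := fun n => c * eLpNorm (u n - v) p θ.vol) ?_ (fun _ => zero_le) fun n => ?_
  · simpa using ENNReal.Tendsto.const_mul huv (Or.inr hc)
  · have h : (Set.Icc (-R) R ×ˢ Set.Icc (-R) R).indicator (reflExt θ (u n))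
        - (Set.Icc (-R) R ×ˢ Set.Icc (-R) R).indicator (reflExt θ v)
        = (Set.Icc (-R) R ×ˢ Set.Icc (-R) R).indicator (reflExt θ (u n - v)) :=
      (Set.indicator_sub' _ _ _).symm
    rw [h, eLpNorm_indicator_eq_eLpNorm_restrict (measurableSet_Icc.prod measurableSet_Icc)]
    exact hle _ ((hu n).sub hv)

/-- The function `y ↦ V (x - y)` on `S`, in `L^p`. -/
def flipShift (S : Rect) {p : ℝ≥0∞} [Fact (1 ≤ p)] (V : Lp ℝ p (volume : Measure (ℝ × ℝ)))
    (x : ℝ × ℝ) : Lp ℝ p S.vol :=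
  LpToLpRestrictCLM (ℝ × ℝ) ℝ ℝ volume p S.toSet
    (Lp.compMeasurePreserving (fun y => x - y) (Measure.measurePreserving_sub_left volume x) V)

theorem rectConv_eq_lpDual (S θ : Rect) {R : ℝ} {x : ℝ × ℝ}
    (hx : ∀ y ∈ S.toSet, x - y ∈ Set.Icc (-R) R ×ˢ Set.Icc (-R) R)
    {p q : ℝ≥0∞} [Fact (1 ≤ p)] [Fact (1 ≤ q)] [p.HolderConjugate q]
    {u : ℝ × ℝ → ℝ} (hu : MemLp u p θ.vol) (w : Lp ℝ q S.vol) :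
    rectConv S (reflExt θ u) w x = lpDual S.vol p q (flipShift S (cutExt θ R hu) x) w := by
  rw [lpDual_apply]
  unfold rectConv
  have hmp := Measure.measurePreserving_sub_left (volume : Measure (ℝ × ℝ)) x
  have h1 : flipShift S (cutExt θ R hu) x =ᵐ[S.vol] _ :=
    LpToLpRestrictCLM_coeFn ℝ S.toSet (Lp.compMeasurePreserving (fun y => x - y) hmp
      (cutExt θ R hu))
  have h2 := ae_restrict_of_ae (s := S.toSet)
    (Lp.coeFn_compMeasurePreserving (cutExt θ R hu) hmp)
  have h3 := ae_restrict_of_ae (s := S.toSet) (hmp.quasiMeasurePreserving.ae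
    ((memLp_indicator_iff_restrict (measurableSet_Icc.prod measurableSet_Icc)).2
      (memLp_reflExt θ hu R)).coeFn_toLp)
  refine integral_congr_ae ?_
  filter_upwards [h1, h2, h3, ae_restrict_mem S.measurableSet] with y h1 h2 h3 hy
  rw [h1, h2, Function.comp_apply]
  refine (mul_comm _ _).trans (congrArg (· * _) ?_)
  refine Eq.trans ?_ h3.symm
  rw [Set.indicator_of_mem (hx y hy)]

theorem tendsto_flipShift (S : Rect) {p : ℝ≥0∞} [Fact (1 ≤ p)] (hp : p ≠ ∞)
    {V : ℕ → Lp ℝ p (volume : Measure (ℝ × ℝ))} {V₀ : Lp ℝ p (volume : Measure (ℝ × ℝ))}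
    (hV : Tendsto V atTop (𝓝 V₀)) (x₀ : ℝ × ℝ) :
    Tendsto (fun z : ℕ × (ℝ × ℝ) => flipShift S (V z.1) z.2) (atTop ×ˢ 𝓝 x₀)
      (𝓝 (flipShift S V₀ x₀)) := by
  let g : ℝ × ℝ → C(ℝ × ℝ, ℝ × ℝ) := fun x => ⟨fun y => x - y, by fun_prop⟩
  have hg : Continuous g := ContinuousMap.continuous_of_continuous_uncurry _ (by
    change Continuous fun z : (ℝ × ℝ) × (ℝ × ℝ) => z.1 - z.2
    fun_prop)
  exact ((LpToLpRestrictCLM (ℝ × ℝ) ℝ ℝ volume p S.toSet).continuous.tendsto _).comp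
    ((hV.comp tendsto_fst).compMeasurePreservingLp ((hg.tendsto x₀).comp tendsto_snd)
      (fun z => Measure.measurePreserving_sub_left volume z.2)
      (Measure.measurePreserving_sub_left volume x₀) hp)

/-- If the functions `u n` converge strongly and the kernels `w n` converge weakly, then the
convolutions converge continuously, that is, jointly in the index and the point. -/
theorem tendsto_rectConv (θ S : Rect) {p q : ℝ≥0∞} [Fact (1 ≤ p)] [Fact (1 ≤ q)]
    (hpq : p.HolderConjugate q) (hp : p ≠ ∞) {u : ℕ → ℝ × ℝ → ℝ} {v : ℝ × ℝ → ℝ}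
    (hu : ∀ n, MemLp (u n) p θ.vol) (hv : MemLp v p θ.vol)
    (huv : Tendsto (fun n => eLpNorm (u n - v) p θ.vol) atTop (𝓝 0))
    {w : ℕ → Lp ℝ q S.vol} {w₀ : Lp ℝ q S.vol} (hw : WeaklyTendsto w w₀) (x₀ : ℝ × ℝ) :
    Tendsto (fun z : ℕ × (ℝ × ℝ) => rectConv S (reflExt θ (u z.1)) (w z.1) z.2)
      (atTop ×ˢ 𝓝 x₀) (𝓝 (rectConv S (reflExt θ v) w₀ x₀)) := by
  obtain ⟨M, hM⟩ := hw.exists_norm_le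
  let Q : Rect := ⟨x₀.1 - 1, x₀.1 + 1, x₀.2 - 1, x₀.2 + 1, by linarith, by linarith⟩
  obtain ⟨R, hR⟩ := exists_box Q S
  have hQ : Q.toSet ∈ 𝓝 x₀ := (isOpen_Ioo.prod isOpen_Ioo).mem_nhds
    ⟨⟨by simp [Q], by simp [Q]⟩, ⟨by simp [Q], by simp [Q]⟩⟩
  have hf := tendsto_flipShift S hp (tendsto_cutExt θ R hp hu hv huv) x₀
  have h1 : Tendsto (fun z : ℕ × (ℝ × ℝ) => lpDual S.vol p q
      (flipShift S (cutExt θ R (hu z.1)) z.2 - flipShift S (cutExt θ R hv) x₀) (w z.1))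
      (atTop ×ˢ 𝓝 x₀) (𝓝 0) := by
    refine squeeze_zero_norm (a := fun z => ‖lpDual S.vol p q‖ *
      ‖flipShift S (cutExt θ R (hu z.1)) z.2 - flipShift S (cutExt θ R hv) x₀‖ * M) (fun z => ?_) ?_
    · exact ((lpDual S.vol p q).le_opNorm₂ _ _).trans
        (mul_le_mul_of_nonneg_left (hM _) (by positivity))
    · have := (((tendsto_iff_norm_sub_tendsto_zero.1 hf).const_mul ‖lpDual S.vol p q‖).mul_const M)
      simpa using this
  have h2 := (hw (lpDual S.vol p q (flipShift S (cutExt θ R hv) x₀))).comp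
    (tendsto_fst (f := atTop) (g := 𝓝 x₀))
  have h3 := h1.add h2
  rw [zero_add, ← rectConv_eq_lpDual S θ (hR x₀ (mem_of_mem_nhds hQ))] at h3
  refine h3.congr' ?_
  filter_upwards [tendsto_snd.eventually hQ] with z hz
  rw [rectConv_eq_lpDual S θ (hR z.2 hz) (hu z.1), map_sub, sub_apply]
  simp

/-! ### Pixel grids -/

theorem floor_add_half_mul_div {h : ℝ} (hh : 0 < h) (a : ℝ) (i : ℕ) :
    ⌊(a + ((i : ℝ) + 1 / 2) * h - a) / h⌋₊ = i := by
  rw [add_sub_cancel_left, mul_div_cancel_right₀ _ hh.ne', Nat.floor_eq_iff (by positivity)]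
  constructor <;> linarith

theorem samples_stepFun (θ : Rect) {h : ℝ} (hh : 0 < h) (U : ℕ → ℕ → ℝ) :
    samples θ h (stepFun θ h U) = U := by
  funext i j
  simp only [samples, stepFun, Rect.center, floor_add_half_mul_div hh]

/-- The matrix of values of `φ`, sampled at resolution `r` and then downsampled. -/
def pooled (θ : Rect) (r : ℝ) (s : ℕ+) (f : (Fin s → Fin s → ℝ) → ℝ) (φ : ℝ × ℝ → ℝ) :
    ℕ → ℕ → ℝ :=
  fun k l => f fun i j => φ (θ.center r (s * k + i) (s * l + j))

/-- The matrix of values of the upsampling of the matrix `U` of values on the cells of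
side `s h`. -/
def refined (θ : Rect) (h : ℝ) (s : ℕ+) (g : (Fin 2 → Fin 2 → ℝ) → Fin s → Fin s → ℝ)
    (U : ℕ → ℕ → ℝ) : ℕ → ℕ → ℝ :=
  fun i j => g (fun α β => U
        (min (i / s + α) (⌊(θ.b - θ.a) / (s * h)⌋₊ - 1))
        (min (j / s + β) (⌊(θ.d - θ.c) / (s * h)⌋₊ - 1)))
      ⟨i % s, Nat.mod_lt i s.pos⟩ ⟨j % s, Nat.mod_lt j s.pos⟩

theorem downsample_projPC (θ : Rect) {r : ℝ} (hr : 0 < r) (s : ℕ+)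
    (f : (Fin s → Fin s → ℝ) → ℝ) (φ : ℝ × ℝ → ℝ) :
    downsample θ r s f (projPC θ r φ) = stepFun θ (s * r) (pooled θ r s f φ) := by
  unfold downsample projPC
  rw [samples_stepFun θ hr]
  rfl

theorem upsample_downsample_projPC (θ : Rect) {r h : ℝ} (hr : 0 < r) {s s' : ℕ+}
    (hres : (s' : ℝ) * h = s * r) (f : (Fin s → Fin s → ℝ) → ℝ)
    (g : (Fin 2 → Fin 2 → ℝ) → Fin s' → Fin s' → ℝ) (φ : ℝ × ℝ → ℝ) :
    upsample θ h s' g (downsample θ r s f (projPC θ r φ))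
      = stepFun θ h (refined θ h s' g (pooled θ r s f φ)) := by
  have hs : (0 : ℝ) < s := by exact_mod_cast s.pos
  unfold upsample
  rw [downsample_projPC θ hr, hres, samples_stepFun θ (by positivity), ← hres]
  rfl

/-- A centre of a cell of side `r` inside the coarse interval `k'` of length `H = s r` is close to
all points of the coarse interval `k`, if `k` and `k'` are equal or adjacent. -/
theorem abs_center_sub_le {a x r H : ℝ} {s k k' i : ℕ} (hr : 0 < r) (hH : H = s * r)
    (hk : k * H ≤ x - a) (hk1 : x - a ≤ (k + 1) * H) (h1 : k' ≤ k + 1) (h2 : k ≤ k' + 1)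
    (hi : i < s) : |a + (((s * k' + i : ℕ) : ℝ) + 1 / 2) * r - x| ≤ 2 * H := by
  have hs : (i : ℝ) + 1 ≤ s := by exact_mod_cast hi
  have h1' : (k' : ℝ) ≤ k + 1 := by exact_mod_cast h1
  have h2' : (k : ℝ) ≤ k' + 1 := by exact_mod_cast h2
  have hH0 : 0 ≤ H := by rw [hH]; positivity
  have e : (((s * k' + i : ℕ) : ℝ) + 1 / 2) * r = k' * H + (i + 1 / 2) * r := by
    rw [hH]; push_cast; ring
  have e1 : ((i : ℝ) + 1 / 2) * r ≤ H := by
    rw [hH]; exact mul_le_mul_of_nonneg_right (by linarith) hr.le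
  have e2 : 0 ≤ ((i : ℝ) + 1 / 2) * r := by positivity
  have e3 := mul_le_mul_of_nonneg_right h1' hH0
  have e4 := mul_le_mul_of_nonneg_right h2' hH0
  rw [e, abs_le]
  constructor <;> nlinarith

theorem floor_mul_le {t H : ℝ} (hH : 0 < H) (ht : 0 ≤ t) :
    (⌊t / H⌋₊ : ℝ) * H ≤ t ∧ t ≤ (⌊t / H⌋₊ + 1) * H := by
  constructor
  · rw [← le_div_iff₀ hH]; exact Nat.floor_le (by positivity)
  · rw [← div_le_iff₀ hH]; exact (Nat.lt_floor_add_one _).le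

theorem floor_div_eq {t h : ℝ} (s : ℕ+) : ⌊t / h⌋₊ / (s : ℕ) = ⌊t / ((s : ℕ) * h)⌋₊ := by
  rw [mul_comm, ← div_div, Nat.floor_div_natCast]

/-- The values of the downsampling of `φ` lie between bounds for `φ` near the point. -/
theorem pooled_bounds (θ : Rect) {r : ℝ} (hr : 0 < r) {s : ℕ+} {f : (Fin s → Fin s → ℝ) → ℝ}
    (hf : ∀ U lo hi, (∀ i j, lo ≤ U i j ∧ U i j ≤ hi) → lo ≤ f U ∧ f U ≤ hi)
    {φ : ℝ × ℝ → ℝ} {x : ℝ × ℝ} (hx : x ∈ θ.toSet) {lo hi : ℝ}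
    (hφ : ∀ y, dist y x ≤ 2 * (s * r) → lo ≤ φ y ∧ φ y ≤ hi) {k' l' : ℕ}
    (hk : k' ≤ ⌊(x.1 - θ.a) / (s * r)⌋₊ + 1) (hk' : ⌊(x.1 - θ.a) / (s * r)⌋₊ ≤ k' + 1)
    (hl : l' ≤ ⌊(x.2 - θ.c) / (s * r)⌋₊ + 1) (hl' : ⌊(x.2 - θ.c) / (s * r)⌋₊ ≤ l' + 1) :
    lo ≤ pooled θ r s f φ k' l' ∧ pooled θ r s f φ k' l' ≤ hi := by
  have hs : (0 : ℝ) < s := by exact_mod_cast s.pos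
  have hH : 0 < (s : ℝ) * r := by positivity
  have b1 := floor_mul_le hH (sub_nonneg.2 hx.1.1.le)
  have b2 := floor_mul_le hH (sub_nonneg.2 hx.2.1.le)
  refine hf _ _ _ fun i j => hφ _ ?_
  rw [Prod.dist_eq, max_le_iff, Real.dist_eq, Real.dist_eq]
  exact ⟨abs_center_sub_le hr rfl b1.1 b1.2 hk hk' i.2,
    abs_center_sub_le hr rfl b2.1 b2.2 hl hl' j.2⟩

theorem stepFun_pooled_bounds (θ : Rect) {r : ℝ} (hr : 0 < r) {s : ℕ+}
    {f : (Fin s → Fin s → ℝ) → ℝ}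
    (hf : ∀ U lo hi, (∀ i j, lo ≤ U i j ∧ U i j ≤ hi) → lo ≤ f U ∧ f U ≤ hi)
    {φ : ℝ × ℝ → ℝ} {x : ℝ × ℝ} (hx : x ∈ θ.toSet) {lo hi : ℝ}
    (hφ : ∀ y, dist y x ≤ 2 * (s * r) → lo ≤ φ y ∧ φ y ≤ hi) :
    lo ≤ stepFun θ (s * r) (pooled θ r s f φ) x
      ∧ stepFun θ (s * r) (pooled θ r s f φ) x ≤ hi :=
  pooled_bounds θ hr hf hx hφ (Nat.le_succ _) (Nat.le_succ _) (Nat.le_succ _) (Nat.le_succ _)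

/-- The index of a neighbouring coarse cell, clamped at the boundary, still belongs to an equal or
adjacent cell. -/
theorem clamped_index {t L H : ℝ} (hH : 0 < H) (htL : t ≤ L) (α : Fin 2) :
    min (⌊t / H⌋₊ + (α : ℕ)) (⌊L / H⌋₊ - 1) ≤ ⌊t / H⌋₊ + 1 ∧
      ⌊t / H⌋₊ ≤ min (⌊t / H⌋₊ + (α : ℕ)) (⌊L / H⌋₊ - 1) + 1 := by
  have h1 : ⌊t / H⌋₊ ≤ ⌊L / H⌋₊ := Nat.floor_mono (by gcongr)
  have := α.2
  omega

theorem stepFun_refined_bounds (θ : Rect) {r h : ℝ} (hr : 0 < r) {s s' : ℕ+}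
    (hres : (s' : ℝ) * h = s * r) {f : (Fin s → Fin s → ℝ) → ℝ}
    {g : (Fin 2 → Fin 2 → ℝ) → Fin s' → Fin s' → ℝ}
    (hf : ∀ U lo hi, (∀ i j, lo ≤ U i j ∧ U i j ≤ hi) → lo ≤ f U ∧ f U ≤ hi)
    (hg : ∀ U lo hi, (∀ i j, lo ≤ U i j ∧ U i j ≤ hi) → ∀ i j, lo ≤ g U i j ∧ g U i j ≤ hi)
    {φ : ℝ × ℝ → ℝ} {x : ℝ × ℝ} (hx : x ∈ θ.toSet) {lo hi : ℝ}
    (hφ : ∀ y, dist y x ≤ 2 * (s * r) → lo ≤ φ y ∧ φ y ≤ hi) :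
    lo ≤ stepFun θ h (refined θ h s' g (pooled θ r s f φ)) x
      ∧ stepFun θ h (refined θ h s' g (pooled θ r s f φ)) x ≤ hi := by
  have hs : (0 : ℝ) < s := by exact_mod_cast s.pos
  have hH : 0 < (s : ℝ) * r := by positivity
  refine hg _ _ _ (fun α β => ?_) _ _
  rw [floor_div_eq, floor_div_eq, hres]
  obtain ⟨h1, h2⟩ := clamped_index hH (sub_le_sub_right hx.1.2.le θ.a) α
  obtain ⟨h3, h4⟩ := clamped_index hH (sub_le_sub_right hx.2.2.le θ.c) β
  exact pooled_bounds θ hr hf hx hφ h1 h2 h3 h4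

/-- Continuous convergence is preserved by operators whose values lie between bounds for the
function in a neighbourhood of vanishing diameter. -/
theorem tendsto_of_local_bounds {S : Set (ℝ × ℝ)} {φ Φ : ℕ → ℝ × ℝ → ℝ} {δ : ℕ → ℝ}
    (hδ : Tendsto δ atTop (𝓝 0))
    (hΦ : ∀ n, ∀ x ∈ S, ∀ lo hi : ℝ, (∀ y, dist y x ≤ δ n → lo ≤ φ n y ∧ φ n y ≤ hi) →
      lo ≤ Φ n x ∧ Φ n x ≤ hi) {x₀ : ℝ × ℝ} {c : ℝ}
    (hφ : Tendsto (fun z : ℕ × (ℝ × ℝ) => φ z.1 z.2) (atTop ×ˢ 𝓝 x₀) (𝓝 c)) :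
    Tendsto (fun z : ℕ × (ℝ × ℝ) => Φ z.1 z.2) (atTop ×ˢ 𝓝[S] x₀) (𝓝 c) := by
  rw [Metric.tendsto_nhds]
  intro ε hε
  have h1 := Metric.tendsto_nhds.1 hφ (ε / 2) (by positivity)
  obtain ⟨P, hP, Q, hQ, hPQ⟩ := Filter.eventually_prod_iff.1 h1
  obtain ⟨η, hη, hQ⟩ := Metric.eventually_nhds_iff.1 hQ
  have h2 : ∀ᶠ n in atTop, δ n < η / 2 := hδ.eventually_lt_const (by positivity)
  have h3 : ∀ᶠ x in 𝓝[S] x₀, x ∈ S ∧ dist x x₀ < η / 2 :=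
    eventually_mem_nhdsWithin.and
      (mem_nhdsWithin_of_mem_nhds (Metric.ball_mem_nhds x₀ (by positivity)))
  filter_upwards [(hP.and h2).prod_mk h3] with z hz
  obtain ⟨⟨hz1, hz2⟩, hz3, hz4⟩ := hz
  have h4 := hΦ z.1 z.2 hz3 (c - ε / 2) (c + ε / 2) fun y hy => by
    have hy0 : dist y x₀ < η := by linarith [dist_triangle y z.2 x₀]
    have := abs_lt.1 (hPQ hz1 (hQ hy0))
    constructor <;> linarith
  rw [Real.dist_eq]
  exact lt_of_le_of_lt (abs_le.2 ⟨by linarith, by linarith⟩) (half_lt_self hε)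

theorem Rect.exists_isCompact (θ : Rect) : ∃ K : Set (ℝ × ℝ), IsCompact K ∧ θ.toSet ⊆ K :=
  ⟨Set.Icc θ.a θ.b ×ˢ Set.Icc θ.c θ.d, isCompact_Icc.prod isCompact_Icc,
    Set.prod_mono Set.Ioo_subset_Icc_self Set.Ioo_subset_Icc_self⟩

/-- On a bounded set, continuous convergence to a continuous function is uniform. -/
theorem tendstoUniformlyOn_of_tendsto (θ : Rect) {F : ℕ → ℝ × ℝ → ℝ} {φ : ℝ × ℝ → ℝ}
    (hφ : Continuous φ)
    (hF : ∀ x₀, Tendsto (fun z : ℕ × (ℝ × ℝ) => F z.1 z.2) (atTop ×ˢ 𝓝[θ.toSet] x₀)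
      (𝓝 (φ x₀))) : TendstoUniformlyOn F φ atTop θ.toSet := by
  obtain ⟨K, hK, hθK⟩ := θ.exists_isCompact
  rw [Metric.tendstoUniformlyOn_iff]
  intro ε hε
  have key : ∀ᶠ n in atTop, ∀ x ∈ K ∩ θ.toSet, dist (φ x) (F n x) < ε := by
    refine hK.induction_on (p := fun s => ∀ᶠ n in atTop, ∀ x ∈ s ∩ θ.toSet,
      dist (φ x) (F n x) < ε) (by simp) ?_ ?_ ?_
    · intro s t hst ht
      filter_upwards [ht] with n hn x hx using hn x ⟨hst hx.1, hx.2⟩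
    · intro s t hs ht
      filter_upwards [hs, ht] with n hn1 hn2 x hx
      rcases hx with ⟨hx | hx, hx'⟩
      exacts [hn1 x ⟨hx, hx'⟩, hn2 x ⟨hx, hx'⟩]
    · intro x₀ _
      have h1 := Metric.tendsto_nhds.1 (hF x₀) (ε / 2) (by positivity)
      obtain ⟨P, hP, Q, hQ, hPQ⟩ := Filter.eventually_prod_iff.1 h1
      have h2 := Metric.tendsto_nhds.1 (hφ.tendsto x₀) (ε / 2) (by positivity)
      refine ⟨_, mem_nhdsWithin_of_mem_nhds ((eventually_nhdsWithin_iff.1 hQ).and h2), ?_⟩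
      filter_upwards [hP] with n hn x hx
      obtain ⟨⟨hx1, hx2⟩, hx3⟩ := hx
      have h3 : dist (F n x) (φ x₀) < ε / 2 := hPQ hn (hx1 hx3)
      rw [dist_comm] at h3
      exact (dist_triangle _ _ _).trans_lt (by linarith)
  filter_upwards [key] with n hn x hx using hn x ⟨hθK hx, hx⟩

theorem tendsto_eLpNorm_of_tendstoUniformlyOn (θ : Rect) {F : ℕ → ℝ × ℝ → ℝ} {φ : ℝ × ℝ → ℝ}
    (hF : TendstoUniformlyOn F φ atTop θ.toSet) (p : ℝ≥0∞) :
    Tendsto (fun n => eLpNorm (F n - φ) p θ.vol) atTop (𝓝 0) := by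
  obtain ⟨c, hc⟩ : ∃ c : ℝ≥0∞, c = θ.vol Set.univ ^ p.toReal⁻¹ := ⟨_, rfl⟩
  have hc' : c ≠ ∞ := hc ▸ ENNReal.rpow_ne_top_of_nonneg (by positivity) (measure_ne_top _ _)
  rw [ENNReal.tendsto_nhds_zero]
  intro ε hε
  have h0 : Tendsto (fun t : ℝ => c * ENNReal.ofReal t) (𝓝[>] 0) (𝓝 0) := by
    have := ENNReal.Tendsto.const_mul (a := c) (ENNReal.tendsto_ofReal
      (tendsto_nhdsWithin_of_tendsto_nhds (s := Set.Ioi 0) (tendsto_id (x := 𝓝 (0 : ℝ)))))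
      (Or.inr hc')
    simpa using this
  obtain ⟨t, ht, ht0⟩ := ((h0.eventually (ge_mem_nhds hε)).and self_mem_nhdsWithin).exists
  filter_upwards [Metric.tendstoUniformlyOn_iff.1 hF t ht0] with n hn
  refine le_trans ?_ ht
  rw [hc]
  refine eLpNorm_le_of_ae_bound ?_
  filter_upwards [ae_restrict_mem θ.measurableSet] with x hx
  have := (hn x hx).le
  rwa [dist_comm, dist_eq_norm] at this

theorem finite_floor_image (a b e h : ℝ) :
    ((fun t : ℝ => ⌊(t - a) / h⌋₊) '' Set.Ioo b e).Finite := by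
  refine (Set.finite_Iic ⌊(|a| + |b| + |e|) / |h|⌋₊).subset ?_
  rintro _ ⟨t, ht, rfl⟩
  refine Nat.floor_mono ((le_abs_self _).trans ?_)
  rw [abs_div]
  gcongr
  rw [abs_le]
  constructor <;> linarith [ht.1, ht.2, neg_abs_le a, neg_abs_le b, neg_abs_le e,
    le_abs_self a, le_abs_self b, le_abs_self e, abs_nonneg a, abs_nonneg b, abs_nonneg e]

/-- Functions on a fixed grid, which has finitely many cells, converge uniformly if their values
converge. -/
theorem tendstoUniformlyOn_stepFun (θ : Rect) (h : ℝ) {U : ℕ → ℕ → ℕ → ℝ} {V : ℕ → ℕ → ℝ}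
    (hU : ∀ i j, Tendsto (fun n => U n i j) atTop (𝓝 (V i j))) :
    TendstoUniformlyOn (fun n => stepFun θ h (U n)) (stepFun θ h V) atTop θ.toSet := by
  rw [Metric.tendstoUniformlyOn_iff]
  intro ε hε
  have hfin := (finite_floor_image θ.a θ.a θ.b h).prod (finite_floor_image θ.c θ.c θ.d h)
  have : ∀ᶠ n in atTop, ∀ k ∈ ((fun t : ℝ => ⌊(t - θ.a) / h⌋₊) '' Set.Ioo θ.a θ.b) ×ˢ
      ((fun t : ℝ => ⌊(t - θ.c) / h⌋₊) '' Set.Ioo θ.c θ.d),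
      dist (U n k.1 k.2) (V k.1 k.2) < ε :=
    (hfin.eventually_all).2 fun k _ => Metric.tendsto_nhds.1 (hU k.1 k.2) ε hε
  filter_upwards [this] with n hn x hx
  rw [dist_comm]
  exact hn (_, _) ⟨⟨x.1, hx.1, rfl⟩, ⟨x.2, hx.2, rfl⟩⟩

theorem tendsto_pooled (θ : Rect) (r : ℝ) {s : ℕ+} {f : (Fin s → Fin s → ℝ) → ℝ}
    (hf : Continuous f) {φ : ℕ → ℝ × ℝ → ℝ} {ψ : ℝ × ℝ → ℝ}
    (hφ : ∀ x, Tendsto (fun n => φ n x) atTop (𝓝 (ψ x))) (k l : ℕ) :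
    Tendsto (fun n => pooled θ r s f (φ n) k l) atTop (𝓝 (pooled θ r s f ψ k l)) :=
  (hf.tendsto _).comp (tendsto_pi_nhds.2 fun _ => tendsto_pi_nhds.2 fun _ => hφ _)

theorem tendsto_refined (θ : Rect) (h : ℝ) {s : ℕ+}
    {g : (Fin 2 → Fin 2 → ℝ) → Fin s → Fin s → ℝ}
    (hg : Continuous g) {U : ℕ → ℕ → ℕ → ℝ} {V : ℕ → ℕ → ℝ}
    (hU : ∀ i j, Tendsto (fun n => U n i j) atTop (𝓝 (V i j))) (k l : ℕ) :
    Tendsto (fun n => refined θ h s g (U n) k l) atTop (𝓝 (refined θ h s g V k l)) :=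
  tendsto_pi_nhds.1 (tendsto_pi_nhds.1 ((hg.tendsto _).comp
    (tendsto_pi_nhds.2 fun _ => tendsto_pi_nhds.2 fun _ => hU _ _)) _) _

/-! ### Convergence of the networks -/

namespace CNN

variable {m : ℕ}

theorem res_pos (C : CNN m) {h : ℝ} (hh : 0 < h) (l : ℕ) (hl : l < m + 1) : 0 < C.res h l hl := by
  induction l with
  | zero => exact hh
  | succ l ih =>
    have h1 := ih (by omega)
    have h2 : 0 < ((C.sD ⟨l, by omega⟩ : ℕ) : ℝ) := by exact_mod_cast (C.sD _).pos
    have h3 : 0 < ((C.sU ⟨l + 1, hl⟩ : ℕ) : ℝ) := by exact_mod_cast (C.sU _).pos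
    rw [res]
    positivity

theorem tendsto_res (C : CNN m) {h : ℕ → ℝ} (hh : Tendsto h atTop (𝓝 0)) (l : ℕ)
    (hl : l < m + 1) : Tendsto (fun n => C.res (h n) l hl) atTop (𝓝 0) := by
  induction l with
  | zero => exact hh
  | succ l ih =>
    have := ((ih (by omega)).mul_const ((C.sD ⟨l, by omega⟩ : ℕ) : ℝ)).div_const
      ((C.sU ⟨l + 1, hl⟩ : ℕ) : ℝ)
    simpa [res] using this

theorem sU_mul_res_succ (C : CNN m) (h : ℝ) (l : ℕ) (hl : l + 1 < m + 1) :
    ((C.sU ⟨l + 1, hl⟩ : ℕ) : ℝ) * C.res h (l + 1) hl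
      = (C.sD ⟨l, by omega⟩ : ℕ) * C.res h l (by omega) := by
  have h3 : ((C.sU ⟨l + 1, hl⟩ : ℕ) : ℝ) ≠ 0 := by exact_mod_cast (C.sU _).ne_zero
  rw [res, mul_div_cancel₀ _ h3, mul_comm]

theorem memLp_affine (C : CNN m) {p q : ℝ≥0∞} (hpq : p.HolderConjugate q) (l : Fin (m + 1))
    {w v : ℝ × ℝ → ℝ} (hw : MemLp w q (C.S l).vol) (β : ℝ)
    (hv : MemLp v p (C.Ω l.castSucc).vol) : MemLp (C.affine l w β v) ∞ (C.Ω l.succ).vol :=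
  (memLp_rectConv _ _ _ hpq hv hw).add (memLp_const _)

theorem memLp_layerIn (C : CNN m) (hact : ∃ K : ℝ≥0, LipschitzWith K C.act)
    {p q : ℝ≥0∞} (hpq : p.HolderConjugate q) {u : ℝ × ℝ → ℝ} (hu : MemLp u p C.inRect.vol)
    {w : Fin (m + 1) → ℝ × ℝ → ℝ} (hw : ∀ l, MemLp (w l) q (C.S l).vol)
    (b : Fin (m + 1) → ℝ) (l : ℕ) (hl : l < m + 1) :
    MemLp (C.layerIn w b u l hl) p (C.Ω (Fin.castSucc ⟨l, hl⟩)).vol := by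
  obtain ⟨K, hK⟩ := hact
  induction l with
  | zero => exact hu
  | succ l ih =>
    have h1 := C.memLp_affine hpq ⟨l, by omega⟩ (hw ⟨l, by omega⟩) (b ⟨l, by omega⟩)
      (ih (by omega))
    have h2 : MemLp (fun x => C.act (C.affine ⟨l, by omega⟩ (w ⟨l, by omega⟩) (b ⟨l, by omega⟩)
        (C.layerIn w b u l (by omega)) x) - C.act 0) ∞
        (C.Ω (Fin.succ ⟨l, by omega⟩)).vol := by
      refine h1.of_le_mul (c := K) ?_ (Eventually.of_forall fun x => ?_)
      · exact (hK.continuous.comp_aestronglyMeasurable h1.1).sub aestronglyMeasurable_const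
      · have := hK.dist_le_mul (C.affine ⟨l, by omega⟩ (w ⟨l, by omega⟩) (b ⟨l, by omega⟩)
          (C.layerIn w b u l (by omega)) x) 0
        simpa [dist_eq_norm] using this
    have h3 := (h2.add (memLp_const (C.act 0))).mono_exponent (p := p) le_top
    refine h3.ae_eq (Eventually.of_forall fun x => ?_)
    simp [layerIn]

theorem memLp_layerInH (C : CNN m) (h : ℝ) {p : ℝ≥0∞} {u : ℝ × ℝ → ℝ}
    (hu : MemLp u p C.inRect.vol) (w : Fin (m + 1) → ℝ × ℝ → ℝ) (b : Fin (m + 1) → ℝ) (l : ℕ)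
    (hl : l < m + 1) : MemLp (C.layerInH h w b u l hl) p (C.Ω (Fin.castSucc ⟨l, hl⟩)).vol := by
  cases l with
  | zero => exact hu
  | succ l =>
    unfold layerInH upsample
    exact (memLp_stepFun _ _ _ _).mono_exponent le_top

/-- A layer of the approximated network is a step function. -/
theorem layerInH_succ (C : CNN m) {h : ℝ} (hh : 0 < h) (w : Fin (m + 1) → ℝ × ℝ → ℝ)
    (b : Fin (m + 1) → ℝ) (u : ℝ × ℝ → ℝ) (l : ℕ) (hl : l + 1 < m + 1) :
    C.layerInH h w b u (l + 1) hl
      = stepFun (C.Ω (Fin.succ ⟨l, by omega⟩)) (C.res h (l + 1) hl)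
        (refined (C.Ω (Fin.succ ⟨l, by omega⟩)) (C.res h (l + 1) hl) (C.sU ⟨l + 1, hl⟩)
          (C.g ⟨l + 1, hl⟩)
          (pooled (C.Ω (Fin.succ ⟨l, by omega⟩)) (C.res h l (by omega)) (C.sD ⟨l, by omega⟩)
            (C.f ⟨l, by omega⟩) fun x => C.act (C.affine ⟨l, by omega⟩ (w ⟨l, by omega⟩)
              (b ⟨l, by omega⟩) (C.layerInH h w b u l (by omega)) x))) :=
  upsample_downsample_projPC _ (C.res_pos hh l _) (C.sU_mul_res_succ h l hl) _ _ _

theorem approxNet_eq (C : CNN m) {h : ℝ} (hh : 0 < h) (w : Fin (m + 1) → ℝ × ℝ → ℝ)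
    (b : Fin (m + 1) → ℝ) (u : ℝ × ℝ → ℝ) :
    C.approxNet h w b u
      = stepFun C.outRect ((C.sD (Fin.last m) : ℕ) * C.res h m (Nat.lt_succ_self m))
        (pooled C.outRect (C.res h m (Nat.lt_succ_self m)) (C.sD (Fin.last m)) (C.f (Fin.last m))
          (C.affine (Fin.last m) (w (Fin.last m)) (b (Fin.last m))
            (C.layerInH h w b u m (Nat.lt_succ_self m)))) :=
  downsample_projPC _ (C.res_pos hh m _) _ _ _

section Limits

variable {p q : ℝ≥0∞} [Fact (1 ≤ p)] [Fact (1 ≤ q)]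

theorem tendsto_affine (C : CNN m) (hpq : p.HolderConjugate q) (hp : p ≠ ∞) (l : Fin (m + 1))
    {u : ℕ → ℝ × ℝ → ℝ} {v : ℝ × ℝ → ℝ} (hu : ∀ n, MemLp (u n) p (C.Ω l.castSucc).vol)
    (hv : MemLp v p (C.Ω l.castSucc).vol)
    (huv : Tendsto (fun n => eLpNorm (u n - v) p (C.Ω l.castSucc).vol) atTop (𝓝 0))
    {w : ℕ → Lp ℝ q (C.S l).vol} {w₀ : Lp ℝ q (C.S l).vol} (hw : WeaklyTendsto w w₀)
    {b : ℕ → ℝ} {β : ℝ} (hb : Tendsto b atTop (𝓝 β)) (x₀ : ℝ × ℝ) :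
    Tendsto (fun z : ℕ × (ℝ × ℝ) => C.affine l (w z.1) (b z.1) (u z.1) z.2)
      (atTop ×ˢ 𝓝 x₀) (𝓝 (C.affine l w₀ β v x₀)) :=
  (tendsto_rectConv _ _ hpq hp hu hv huv hw x₀).add (hb.comp tendsto_fst)

theorem continuous_affine (C : CNN m) (hpq : p.HolderConjugate q) (hp : p ≠ ∞) (l : Fin (m + 1))
    {v : ℝ × ℝ → ℝ} (hv : MemLp v p (C.Ω l.castSucc).vol) (w : Lp ℝ q (C.S l).vol) (β : ℝ) :
    Continuous (C.affine l w β v) := by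
  refine continuous_iff_continuousAt.2 fun x₀ => ?_
  have h := C.tendsto_affine hpq hp l (u := fun _ => v) (fun _ => hv) hv (by simp)
    (WeaklyTendsto.of_tendsto (tendsto_const_nhds (x := w))) (tendsto_const_nhds (x := β)) x₀
  change Tendsto (C.affine l w β v ∘ Prod.snd) (atTop ×ˢ 𝓝 x₀) _ at h
  rwa [← tendsto_map'_iff, map_snd_prod] at h

/-- The layers of the approximated networks converge, as the resolution tends to zero. -/
theorem tendsto_layerInH (C : CNN m) (hact : ∃ K : ℝ≥0, LipschitzWith K C.act)
    (hbounds : C.SamplingBounds) (hpq : p.HolderConjugate q) (hp : p ≠ ∞)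
    {h : ℕ → ℝ} (hpos : ∀ n, 0 < h n) (hlim : Tendsto h atTop (𝓝 0))
    {u : ℕ → ℝ × ℝ → ℝ} {v : ℝ × ℝ → ℝ} (hu : ∀ n, MemLp (u n) p C.inRect.vol)
    (hv : MemLp v p C.inRect.vol)
    (huv : Tendsto (fun n => eLpNorm (u n - v) p C.inRect.vol) atTop (𝓝 0))
    {w : ℕ → (l : Fin (m + 1)) → Lp ℝ q (C.S l).vol} {w₀ : (l : Fin (m + 1)) → Lp ℝ q (C.S l).vol}
    (hw : ∀ l, WeaklyTendsto (fun n => w n l) (w₀ l))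
    {b : ℕ → Fin (m + 1) → ℝ} {β : Fin (m + 1) → ℝ} (hb : Tendsto b atTop (𝓝 β))
    (l : ℕ) (hl : l < m + 1) :
    Tendsto (fun n => eLpNorm (C.layerInH (h n) (fun l => w n l) (b n) (u n) l hl
      - C.layerIn (fun l => w₀ l) β v l hl) p (C.Ω (Fin.castSucc ⟨l, hl⟩)).vol) atTop (𝓝 0) := by
  induction l with
  | zero => exact huv
  | succ l ih =>
    have hl' : l < m + 1 := by omega
    obtain ⟨K, hK⟩ := id hact
    have hmem := C.memLp_layerIn hact hpq hv (fun l => Lp.memLp (w₀ l)) β l hl'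
    have h1 := fun x₀ => (hK.continuous.tendsto _).comp (C.tendsto_affine hpq hp ⟨l, hl'⟩
      (fun n => C.memLp_layerInH (h n) (hu n) (fun l => w n l) (b n) l hl') hmem (ih hl')
      (hw ⟨l, hl'⟩) ((tendsto_pi_nhds.1 hb) ⟨l, hl'⟩) x₀)
    have hc : Continuous (C.layerIn (fun l => w₀ l) β v (l + 1) hl) :=
      hK.continuous.comp (C.continuous_affine hpq hp ⟨l, hl'⟩ hmem (w₀ ⟨l, hl'⟩) (β ⟨l, hl'⟩))
    refine tendsto_eLpNorm_of_tendstoUniformlyOn (C.Ω (Fin.succ ⟨l, hl'⟩))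
      (tendstoUniformlyOn_of_tendsto _ hc fun x₀ => ?_) p
    have hδ : Tendsto (fun n => 2 * (((C.sD ⟨l, hl'⟩ : ℕ) : ℝ) * C.res (h n) l hl')) atTop
        (𝓝 0) := by
      simpa using ((C.tendsto_res hlim l hl').const_mul ((C.sD ⟨l, hl'⟩ : ℕ) : ℝ)).const_mul 2
    refine tendsto_of_local_bounds (φ := fun n x => C.act (C.affine ⟨l, hl'⟩ (w n ⟨l, hl'⟩)
      (b n ⟨l, hl'⟩) (C.layerInH (h n) (fun l => w n l) (b n) (u n) l hl') x))
      (Φ := fun n => C.layerInH (h n) (fun l => w n l) (b n) (u n) (l + 1) hl)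
      (S := (C.Ω (Fin.succ ⟨l, hl'⟩)).toSet) hδ (fun n x hx lo hi hφ => ?_) (h1 x₀)
    rw [C.layerInH_succ (hpos n)]
    exact stepFun_refined_bounds _ (C.res_pos (hpos n) l hl') (C.sU_mul_res_succ (h n) l hl)
      (hbounds.1 _) (hbounds.2 _) hx hφ

/-- The approximated networks converge uniformly, as the resolution tends to zero. -/
theorem tendstoUniformlyOn_approxNet (C : CNN m) (hact : ∃ K : ℝ≥0, LipschitzWith K C.act)
    (hbounds : C.SamplingBounds) (hpq : p.HolderConjugate q) (hp : p ≠ ∞)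
    {h : ℕ → ℝ} (hpos : ∀ n, 0 < h n) (hlim : Tendsto h atTop (𝓝 0))
    {u : ℕ → ℝ × ℝ → ℝ} {v : ℝ × ℝ → ℝ} (hu : ∀ n, MemLp (u n) p C.inRect.vol)
    (hv : MemLp v p C.inRect.vol)
    (huv : Tendsto (fun n => eLpNorm (u n - v) p C.inRect.vol) atTop (𝓝 0))
    {w : ℕ → (l : Fin (m + 1)) → Lp ℝ q (C.S l).vol} {w₀ : (l : Fin (m + 1)) → Lp ℝ q (C.S l).vol}
    (hw : ∀ l, WeaklyTendsto (fun n => w n l) (w₀ l))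
    {b : ℕ → Fin (m + 1) → ℝ} {β : Fin (m + 1) → ℝ} (hb : Tendsto b atTop (𝓝 β)) :
    TendstoUniformlyOn (fun n => C.approxNet (h n) (fun l => w n l) (b n) (u n))
      (C.fsNet (fun l => w₀ l) β v) atTop C.outRect.toSet := by
  have hm := Nat.lt_succ_self m
  have hmem := C.memLp_layerIn hact hpq hv (fun l => Lp.memLp (w₀ l)) β m hm
  have h1 := C.tendsto_affine hpq hp (Fin.last m)
    (fun n => C.memLp_layerInH (h n) (hu n) (fun l => w n l) (b n) m hm) hmem
    (C.tendsto_layerInH hact hbounds hpq hp hpos hlim hu hv huv hw hb m hm)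
    (hw (Fin.last m)) ((tendsto_pi_nhds.1 hb) (Fin.last m))
  refine tendstoUniformlyOn_of_tendsto _
    (C.continuous_affine hpq hp (Fin.last m) hmem (w₀ _) (β _)) fun x₀ => ?_
  have hδ : Tendsto (fun n => 2 * (((C.sD (Fin.last m) : ℕ) : ℝ) * C.res (h n) m hm)) atTop
      (𝓝 0) := by
    simpa using ((C.tendsto_res hlim m hm).const_mul ((C.sD (Fin.last m) : ℕ) : ℝ)).const_mul 2
  refine tendsto_of_local_bounds (φ := fun n => C.affine (Fin.last m) (w n (Fin.last m))
    (b n (Fin.last m)) (C.layerInH (h n) (fun l => w n l) (b n) (u n) m hm))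
    (Φ := fun n => C.approxNet (h n) (fun l => w n l) (b n) (u n)) (S := C.outRect.toSet)
    hδ (fun n x hx lo hi hφ => ?_) (h1 x₀)
  rw [C.approxNet_eq (hpos n)]
  exact stepFun_pooled_bounds _ (C.res_pos (hpos n) m hm) (hbounds.1 _) hx hφ

theorem tendsto_affine_apply (C : CNN m) (hpq : p.HolderConjugate q) (hp : p ≠ ∞)
    (l : Fin (m + 1)) {u : ℕ → ℝ × ℝ → ℝ} {v : ℝ × ℝ → ℝ}
    (hu : ∀ n, MemLp (u n) p (C.Ω l.castSucc).vol) (hv : MemLp v p (C.Ω l.castSucc).vol)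
    (huv : Tendsto (fun n => eLpNorm (u n - v) p (C.Ω l.castSucc).vol) atTop (𝓝 0))
    {w : ℕ → Lp ℝ q (C.S l).vol} {w₀ : Lp ℝ q (C.S l).vol} (hw : WeaklyTendsto w w₀)
    {b : ℕ → ℝ} {β : ℝ} (hb : Tendsto b atTop (𝓝 β)) (x : ℝ × ℝ) :
    Tendsto (fun n => C.affine l (w n) (b n) (u n) x) atTop (𝓝 (C.affine l w₀ β v x)) :=
  (C.tendsto_affine hpq hp l hu hv huv hw hb x).comp
    (tendsto_id.prodMk (tendsto_const_nhds (x := x)))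

/-- The layers of the approximated network at a fixed resolution depend continuously on the
parameters. -/
theorem tendsto_layerInH_of_res (C : CNN m) (hact : ∃ K : ℝ≥0, LipschitzWith K C.act)
    (hcont : C.SamplingContinuous) (hpq : p.HolderConjugate q) (hp : p ≠ ∞)
    {h : ℝ} (hpos : 0 < h) {u : ℝ × ℝ → ℝ} (hu : MemLp u p C.inRect.vol)
    {w : ℕ → (l : Fin (m + 1)) → Lp ℝ q (C.S l).vol} {w₀ : (l : Fin (m + 1)) → Lp ℝ q (C.S l).vol}
    (hw : ∀ l, WeaklyTendsto (fun n => w n l) (w₀ l))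
    {b : ℕ → Fin (m + 1) → ℝ} {β : Fin (m + 1) → ℝ} (hb : Tendsto b atTop (𝓝 β))
    (l : ℕ) (hl : l < m + 1) :
    Tendsto (fun n => eLpNorm (C.layerInH h (fun l => w n l) (b n) u l hl
      - C.layerInH h (fun l => w₀ l) β u l hl) p (C.Ω (Fin.castSucc ⟨l, hl⟩)).vol)
      atTop (𝓝 0) := by
  induction l with
  | zero => simp [layerInH]
  | succ l ih =>
    have hl' : l < m + 1 := by omega
    obtain ⟨K, hK⟩ := id hact
    have h1 := fun x => (hK.continuous.tendsto _).comp (C.tendsto_affine_apply hpq hp ⟨l, hl'⟩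
      (fun n => C.memLp_layerInH h hu (fun l => w n l) (b n) l hl')
      (C.memLp_layerInH h hu (fun l => w₀ l) β l hl') (ih hl')
      (hw ⟨l, hl'⟩) ((tendsto_pi_nhds.1 hb) ⟨l, hl'⟩) x)
    simp_rw [C.layerInH_succ hpos]
    exact tendsto_eLpNorm_of_tendstoUniformlyOn (C.Ω (Fin.succ ⟨l, hl'⟩))
      (tendstoUniformlyOn_stepFun _ _ (tendsto_refined _ _ (hcont.2 _)
        (tendsto_pooled _ _ (hcont.1 _) h1))) p

/-- The approximated network at a fixed resolution depends continuously on the parameters. -/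
theorem tendstoUniformlyOn_approxNet_of_res (C : CNN m)
    (hact : ∃ K : ℝ≥0, LipschitzWith K C.act)
    (hcont : C.SamplingContinuous) (hpq : p.HolderConjugate q) (hp : p ≠ ∞)
    {h : ℝ} (hpos : 0 < h) {u : ℝ × ℝ → ℝ} (hu : MemLp u p C.inRect.vol)
    {w : ℕ → (l : Fin (m + 1)) → Lp ℝ q (C.S l).vol} {w₀ : (l : Fin (m + 1)) → Lp ℝ q (C.S l).vol}
    (hw : ∀ l, WeaklyTendsto (fun n => w n l) (w₀ l))
    {b : ℕ → Fin (m + 1) → ℝ} {β : Fin (m + 1) → ℝ} (hb : Tendsto b atTop (𝓝 β)) :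
    TendstoUniformlyOn (fun n => C.approxNet h (fun l => w n l) (b n) u)
      (C.approxNet h (fun l => w₀ l) β u) atTop C.outRect.toSet := by
  have hm := Nat.lt_succ_self m
  simp_rw [C.approxNet_eq hpos]
  exact tendstoUniformlyOn_stepFun _ _ (tendsto_pooled _ _ (hcont.1 _)
    (C.tendsto_affine_apply hpq hp (Fin.last m)
      (fun n => C.memLp_layerInH h hu (fun l => w n l) (b n) m hm)
      (C.memLp_layerInH h hu (fun l => w₀ l) β m hm)
      (C.tendsto_layerInH_of_res hact hcont hpq hp hpos hu hw hb m hm)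
      (hw (Fin.last m)) ((tendsto_pi_nhds.1 hb) (Fin.last m))))

theorem _root_.WeaklyTendsto.weights {C : CNN m} {w : ℕ → C.Weights q} {w₀ : C.Weights q}
    (hw : WeaklyTendsto w w₀) (l : Fin (m + 1)) : WeaklyTendsto (fun n => w n l) (w₀ l) :=
  hw.map (PiLp.proj q (fun l : Fin (m + 1) => Lp ℝ q (C.S l).vol) l)

/-- The outputs in `L^∞` converge for strongly convergent inputs and weakly convergent kernels, as
the resolution tends to zero. -/
theorem tendsto_NNh (C : CNN m) (hact : ∃ K : ℝ≥0, LipschitzWith K C.act)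
    (hbounds : C.SamplingBounds) (hpq : p.HolderConjugate q) (hp : p ≠ ∞)
    {h : ℕ → ℝ} (hpos : ∀ n, 0 < h n) (hlim : Tendsto h atTop (𝓝 0))
    {u : ℕ → Lp ℝ p C.inRect.vol} {v : Lp ℝ p C.inRect.vol} (hu : Tendsto u atTop (𝓝 v))
    {w : ℕ → C.Weights q} {w₀ : C.Weights q} (hw : WeaklyTendsto w w₀)
    {b : ℕ → Fin (m + 1) → ℝ} {β : Fin (m + 1) → ℝ} (hb : Tendsto b atTop (𝓝 β)) :
    Tendsto (fun n => C.NNh (h n) (u n) (w n) (b n)) atTop (𝓝 (C.NN v w₀ β)) := by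
  rw [Lp.tendsto_Lp_iff_tendsto_eLpNorm'] at hu ⊢
  have h1 := C.tendstoUniformlyOn_approxNet hact hbounds hpq hp hpos hlim
    (fun n => Lp.memLp (u n)) (Lp.memLp v) hu (w := fun n l => w n l) (w₀ := fun l => w₀ l)
    hw.weights hb
  refine (tendsto_eLpNorm_of_tendstoUniformlyOn C.outRect h1 ∞).congr fun n => ?_
  exact eLpNorm_congr_ae ((C.coeFn_NNh (h n) (u n) (w n) (b n)).sub
    (C.coeFn_NN hact hpq v w₀ β)).symm

/-- At a fixed resolution, the output in `L^∞` is weakly continuous in the kernels. -/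
theorem tendsto_NNh_of_res (C : CNN m) (hact : ∃ K : ℝ≥0, LipschitzWith K C.act)
    (hcont : C.SamplingContinuous) (hpq : p.HolderConjugate q) (hp : p ≠ ∞)
    {h : ℝ} (hpos : 0 < h) (u : Lp ℝ p C.inRect.vol)
    {w : ℕ → C.Weights q} {w₀ : C.Weights q} (hw : WeaklyTendsto w w₀)
    {b : ℕ → Fin (m + 1) → ℝ} {β : Fin (m + 1) → ℝ} (hb : Tendsto b atTop (𝓝 β)) :
    Tendsto (fun n => C.NNh h u (w n) (b n)) atTop (𝓝 (C.NNh h u w₀ β)) := by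
  rw [Lp.tendsto_Lp_iff_tendsto_eLpNorm']
  have h1 := C.tendstoUniformlyOn_approxNet_of_res hact hcont hpq hp hpos
    (Lp.memLp u) (w := fun n l => w n l) (w₀ := fun l => w₀ l) hw.weights hb
  refine (tendsto_eLpNorm_of_tendstoUniformlyOn C.outRect h1 ∞).congr fun n => ?_
  exact eLpNorm_congr_ae ((C.coeFn_NNh h u (w n) (b n)).sub (C.coeFn_NNh h u w₀ β)).symm

end Limits

end CNN

/-! ### Piecewise constant kernels -/

/-- The cell `(i, j)` of the grid on `θ`. -/
def cell (θ : Rect) (h : ℝ) (i j : ℕ) : Set (ℝ × ℝ) :=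
  {x | ⌊(x.1 - θ.a) / h⌋₊ = i ∧ ⌊(x.2 - θ.c) / h⌋₊ = j}

theorem measurableSet_cell (θ : Rect) (h : ℝ) (i j : ℕ) : MeasurableSet (cell θ h i j) := by
  have h1 : Measurable fun x : ℝ × ℝ => ⌊(x.1 - θ.a) / h⌋₊ :=
    Nat.measurable_floor.comp ((measurable_fst.sub_const _).div_const _)
  have h2 : Measurable fun x : ℝ × ℝ => ⌊(x.2 - θ.c) / h⌋₊ :=
    Nat.measurable_floor.comp ((measurable_snd.sub_const _).div_const _)
  exact (h1 (measurableSet_singleton i)).inter (h2 (measurableSet_singleton j))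

theorem setIntegral_cell {θ : Rect} {h : ℝ} {U : ℕ → ℕ → ℝ} {v : ℝ × ℝ → ℝ}
    (hv : v =ᵐ[θ.vol] stepFun θ h U) {i j : ℕ} {s : Set (ℝ × ℝ)} (hs : MeasurableSet s)
    (hsub : s ⊆ cell θ h i j) : ∫ x in s, v x ∂θ.vol = θ.vol.real s * U i j := by
  have : ∫ x in s, v x ∂θ.vol = ∫ x in s, U i j ∂θ.vol := by
    refine setIntegral_congr_ae hs ?_
    filter_upwards [hv] with x hx hxs
    rw [hx, stepFun, (hsub hxs).1, (hsub hxs).2]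
  rw [this, setIntegral_const, smul_eq_mul]

/-- Functions that are piecewise constant on a fixed grid are a weakly closed set: they are
characterized by linear equations between integrals. -/
theorem isPC_of_weaklyTendsto {θ : Rect} {h : ℝ} {p q : ℝ≥0∞} [Fact (1 ≤ p)] [Fact (1 ≤ q)]
    (hpq : p.HolderConjugate q) {w : ℕ → Lp ℝ q θ.vol} {w₀ : Lp ℝ q θ.vol}
    (hw : WeaklyTendsto w w₀) (hPC : ∀ n, IsPC θ h (w n)) : IsPC θ h w₀ := by
  have hint : ∀ s, MeasurableSet s →
      Tendsto (fun n => ∫ x in s, w n x ∂θ.vol) atTop (𝓝 (∫ x in s, w₀ x ∂θ.vol)) := by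
    intro s hs
    have := hw (lpDual θ.vol p q (indicatorConstLp p hs (measure_ne_top θ.vol s) 1))
    simpa only [lpDual_indicatorConstLp] using this
  choose U hU using hPC
  have hkey : ∀ i j s, MeasurableSet s → s ⊆ cell θ h i j →
      θ.vol.real (cell θ h i j) * ∫ x in s, w₀ x ∂θ.vol
        = θ.vol.real s * ∫ x in cell θ h i j, w₀ x ∂θ.vol := by
    intro i j s hs hsub
    have h1 := (hint s hs).const_mul (θ.vol.real (cell θ h i j))
    have h2 := (hint _ (measurableSet_cell θ h i j)).const_mul (θ.vol.real s)
    refine tendsto_nhds_unique h1 (h2.congr fun n => ?_)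
    rw [setIntegral_cell (hU n) hs hsub,
      setIntegral_cell (hU n) (measurableSet_cell θ h i j) subset_rfl]
    ring
  -- The values of the limit are its averages over the cells.
  obtain ⟨V, hV⟩ : ∃ V : ℕ → ℕ → ℝ, V = fun i j =>
    (θ.vol.real (cell θ h i j))⁻¹ * ∫ x in cell θ h i j, w₀ x ∂θ.vol := ⟨_, rfl⟩
  refine ⟨V, ?_⟩
  have hcell : ∀ i j, ∀ᵐ x ∂θ.vol, x ∈ cell θ h i j → w₀ x = V i j := by
    intro i j
    rw [← ae_restrict_iff' (measurableSet_cell θ h i j)]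
    have hwi : Integrable w₀ θ.vol := (Lp.memLp w₀).integrable Fact.out
    refine Integrable.ae_eq_of_forall_setIntegral_eq _ _ hwi.restrict (integrable_const _)
      fun s hs _ => ?_
    rw [Measure.restrict_restrict hs, setIntegral_const, smul_eq_mul, hV]
    have h1 := hkey i j _ (hs.inter (measurableSet_cell θ h i j)) Set.inter_subset_right
    rcases eq_or_ne (θ.vol.real (cell θ h i j)) 0 with h0 | h0
    · have h2 : θ.vol (s ∩ cell θ h i j) = 0 :=
        measure_mono_null Set.inter_subset_right
          ((measureReal_eq_zero_iff (measure_ne_top _ _)).1 h0)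
      simp only
      rw [Measure.restrict_eq_zero.2 h2, h0]
      simp
    · simp only
      rw [mul_left_comm, ← h1]
      field_simp
  have hall : ∀ᵐ x ∂θ.vol, ∀ i j, x ∈ cell θ h i j → w₀ x = V i j :=
    ae_all_iff.2 fun i => ae_all_iff.2 fun j => hcell i j
  filter_upwards [hall] with x hx using hx _ _ ⟨rfl, rfl⟩

/-- Continuous functions are approximated uniformly by their projections. -/
theorem tendstoUniformlyOn_projPC (θ : Rect) {r : ℕ → ℝ} (hr : ∀ n, 0 < r n)
    (hlim : Tendsto r atTop (𝓝 0)) {g : ℝ × ℝ → ℝ} (hg : Continuous g) :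
    TendstoUniformlyOn (fun n => projPC θ (r n) g) g atTop θ.toSet := by
  refine tendstoUniformlyOn_of_tendsto θ hg fun x₀ => ?_
  have hδ : Tendsto (fun n => 2 * r n) atTop (𝓝 0) := by simpa using hlim.const_mul 2
  refine tendsto_of_local_bounds (φ := fun _ => g) (Φ := fun n => projPC θ (r n) g)
    (S := θ.toSet) hδ (fun n x hx lo hi hφ => hφ _ ?_) ((hg.tendsto x₀).comp tendsto_snd)
  have b1 := floor_mul_le (hr n) (sub_nonneg.2 hx.1.1.le)
  have b2 := floor_mul_le (hr n) (sub_nonneg.2 hx.2.1.le)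
  have c1 := abs_center_sub_le (s := 1) (i := 0) (hr n) (by simp) b1.1 b1.2 (Nat.le_succ _)
    (Nat.le_succ _) zero_lt_one
  have c2 := abs_center_sub_le (s := 1) (i := 0) (hr n) (by simp) b2.1 b2.2 (Nat.le_succ _)
    (Nat.le_succ _) zero_lt_one
  rw [one_mul, add_zero] at c1 c2
  rw [Prod.dist_eq, max_le_iff, Real.dist_eq, Real.dist_eq]
  exact ⟨c1, c2⟩

/-- Functions in `L^q` are limits of piecewise constant functions on given grids. -/
theorem exists_isPC_tendsto (θ : Rect) {r : ℕ → ℝ} (hr : ∀ n, 0 < r n)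
    (hlim : Tendsto r atTop (𝓝 0)) {q : ℝ≥0∞} [Fact (1 ≤ q)] (hq : q ≠ ∞) (w : Lp ℝ q θ.vol) :
    ∃ v : ℕ → Lp ℝ q θ.vol, (∀ n, IsPC θ (r n) (v n)) ∧ Tendsto v atTop (𝓝 w) := by
  obtain ⟨P, hP⟩ : ∃ P : ℕ → Set (Lp ℝ q θ.vol), P = fun n => {v : Lp ℝ q θ.vol | IsPC θ (r n) v} := ⟨_, rfl⟩
  have hmem : ∀ n (U : ℕ → ℕ → ℝ),
      ((memLp_stepFun θ θ (r n) U).mono_exponent (p := q) le_top).toLp _ ∈ P n := by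
    intro n U
    rw [hP]
    exact ⟨U, MemLp.coeFn_toLp _⟩
  have hdist : ∀ ε > 0, ∀ᶠ n in atTop, Metric.infDist w (P n) < ε := by
    intro ε hε
    obtain ⟨g, -, hg, hgc, hgm⟩ := (Lp.memLp w).exists_hasCompactSupport_eLpNorm_sub_le hq
      (ε := ENNReal.ofReal (ε / 4)) (by simpa using hε)
    have h1 := tendsto_eLpNorm_of_tendstoUniformlyOn θ (tendstoUniformlyOn_projPC θ hr hlim hgc) q
    have h2 : ∀ᶠ n in atTop, eLpNorm (projPC θ (r n) g - g) q θ.vol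
        ≤ ENNReal.ofReal (ε / 4) :=
      ENNReal.tendsto_nhds_zero.1 h1 _ (by simpa using hε)
    filter_upwards [h2] with n hn
    refine (Metric.infDist_le_dist_of_mem (hmem n (samples θ (r n) g))).trans_lt ?_
    have h3 : dist w (hgm.toLp g) ≤ ε / 4 := by
      rw [Lp.dist_def, eLpNorm_congr_ae (EventuallyEq.rfl.sub hgm.coeFn_toLp)]
      exact ENNReal.toReal_le_of_le_ofReal (by positivity) hg
    have h4 : dist (((memLp_stepFun θ θ (r n) (samples θ (r n) g)).mono_exponent
        (p := q) le_top).toLp _) (hgm.toLp g) ≤ ε / 4 := by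
      rw [Lp.dist_def, eLpNorm_congr_ae ((MemLp.coeFn_toLp _).sub hgm.coeFn_toLp)]
      exact ENNReal.toReal_le_of_le_ofReal (by positivity) hn
    have h5 := dist_triangle_right w (((memLp_stepFun θ θ (r n) (samples θ (r n) g)).mono_exponent
        (p := q) le_top).toLp _) (hgm.toLp g)
    linarith
  have hex : ∀ n : ℕ, ∃ v ∈ P n, dist w v < Metric.infDist w (P n) + 1 / ((n : ℝ) + 1) := fun n =>
    (Metric.infDist_lt_iff ⟨_, hmem n fun _ _ => 0⟩).1
      (lt_add_of_pos_right _ Nat.one_div_pos_of_nat)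
  choose v hv hvd using hex
  refine ⟨v, fun n => by have := hv n; rw [hP] at this; exact this, ?_⟩
  rw [tendsto_iff_dist_tendsto_zero]
  have h0 : Tendsto (fun n => Metric.infDist w (P n)) atTop (𝓝 0) := by
    rw [Metric.tendsto_nhds]
    intro ε hε
    filter_upwards [hdist ε hε] with n hn
    rwa [Real.dist_eq, sub_zero, abs_of_nonneg Metric.infDist_nonneg]
  have h1 := h0.add (tendsto_one_div_add_atTop_nhds_zero_nat (𝕜 := ℝ))
  rw [add_zero] at h1
  exact squeeze_zero (fun _ => dist_nonneg) (fun n => by rw [dist_comm]; exact (hvd n).le) h1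

namespace CNN

variable {m : ℕ}

theorem mem_discreteWeights_of_weaklyTendsto (C : CNN m) {p q : ℝ≥0∞} [Fact (1 ≤ p)]
    [Fact (1 ≤ q)] (hpq : p.HolderConjugate q) {h : ℝ} {w : ℕ → C.Weights q} {w₀ : C.Weights q}
    (hw : WeaklyTendsto w w₀) (hmem : ∀ᶠ n in atTop, w n ∈ C.discreteWeights q h) :
    w₀ ∈ C.discreteWeights q h := by
  obtain ⟨N, hN⟩ := eventually_atTop.1 hmem
  intro l
  exact isPC_of_weaklyTendsto hpq
    ((hw.comp_tendsto (tendsto_add_atTop_nat N)).weights l) fun n => hN _ (Nat.le_add_left _ _) l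

theorem exists_discreteWeights_tendsto (C : CNN m) {q : ℝ≥0∞} [Fact (1 ≤ q)] (hq : q ≠ ∞)
    {h : ℕ → ℝ} (hpos : ∀ n, 0 < h n) (hlim : Tendsto h atTop (𝓝 0)) (w : C.Weights q) :
    ∃ v : ℕ → C.Weights q, (∀ n, v n ∈ C.discreteWeights q (h n)) ∧ Tendsto v atTop (𝓝 w) := by
  choose v hv hvw using fun l : Fin (m + 1) => exists_isPC_tendsto (C.S l)
    (fun n => C.res_pos (hpos n) l l.isLt) (C.tendsto_res hlim l l.isLt) hq (w l)
  refine ⟨fun n => WithLp.toLp q fun l => v l n, fun n l => hv l n, ?_⟩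
  exact ((PiLp.continuous_toLp q _).tendsto _).comp (tendsto_pi_nhds.2 hvw)

/-- Bounded sequences of parameters have weakly convergent subsequences. -/
theorem exists_subseq_weaklyTendsto (C : CNN m) {p q : ℝ≥0∞} [Fact (1 ≤ p)]
    [Fact (1 ≤ q)] (hpq : p.HolderConjugate q) (hp : p ≠ ∞) (hq : q ≠ ∞)
    {x : ℕ → C.Params q} {M : ℝ} (hM : ∀ n, ‖x n‖ ≤ M) :
    ∃ z, ∃ k : ℕ → ℕ, StrictMono k ∧ WeaklyTendsto (x ∘ k) z := by
  have h1 : ∀ n, ‖(x n).1‖ ≤ M := fun n => (norm_fst_le _).trans (hM n)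
  have h2 : ∀ n, ‖(x n).2‖ ≤ M := fun n => (norm_snd_le _).trans (hM n)
  have hl : ∀ s : Finset (Fin (m + 1)), ∃ k : ℕ → ℕ, StrictMono k ∧
      ∀ l ∈ s, ∃ z, WeaklyTendsto (fun n => (x (k n)).1 l) z := by
    intro s
    induction s using Finset.induction_on with
    | empty => exact ⟨id, strictMono_id, by simp⟩
    | insert a s _ ih =>
      obtain ⟨k, hk, hs⟩ := ih
      obtain ⟨z, j, hj, hz⟩ := exists_subseq_weaklyTendsto_Lp hpq hp hq
        (w := fun n => (x (k n)).1 a) (M := M)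
        (fun n => (PiLp.norm_apply_le (x (k n)).1 a).trans (h1 _))
      refine ⟨k ∘ j, hk.comp hj, fun l hl => ?_⟩
      rcases Finset.mem_insert.1 hl with rfl | hl
      · exact ⟨z, hz⟩
      · obtain ⟨z', hz'⟩ := hs l hl
        exact ⟨z', hz'.comp_tendsto hj.tendsto_atTop⟩
  obtain ⟨k, hk, hkl⟩ := hl Finset.univ
  choose z hz using fun l => hkl l (Finset.mem_univ l)
  obtain ⟨β, -, j, hj, hβ⟩ := tendsto_subseq_of_bounded
    (Metric.isBounded_closedBall (x := (0 : Fin (m + 1) → ℝ)) (r := M))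
    (x := fun n => (x (k n)).2) (fun n => by simpa using h2 (k n))
  refine ⟨(WithLp.toLp q z, β), k ∘ j, hk.comp hj, fun φ => ?_⟩
  obtain ⟨χ, hχ⟩ : ∃ χ : (l : Fin (m + 1)) → Lp ℝ q (C.S l).vol →L[ℝ] ℝ,
      ∀ v : C.Params q, φ v = ∑ l, χ l (v.1 l) + φ (0, v.2) := by
    let e := (PiLp.continuousLinearEquiv q ℝ fun l : Fin (m + 1) => Lp ℝ q (C.S l).vol)
    let ψ : ((l : Fin (m + 1)) → Lp ℝ q (C.S l).vol) →L[ℝ] ℝ :=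
      (φ.comp (ContinuousLinearMap.inl ℝ _ _)).comp e.symm.toContinuousLinearMap
    refine ⟨fun l => ψ.comp
      (ContinuousLinearMap.single ℝ (fun l : Fin (m + 1) => Lp ℝ q (C.S l).vol) l), fun v => ?_⟩
    have h3 : ∑ l, ContinuousLinearMap.single ℝ (fun l : Fin (m + 1) => Lp ℝ q (C.S l).vol) l
        (v.1 l) = e v.1 := Finset.univ_sum_single (e v.1)
    have h4 : ψ (e v.1) = φ (v.1, 0) := by
      change φ (e.symm (e v.1), 0) = _
      rw [e.symm_apply_apply]
    simp only [ContinuousLinearMap.comp_apply]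
    rw [← map_sum, h3, h4, ← map_add]
    simp
  have h5 : ∀ l, Tendsto (fun n => χ l ((x (k (j n))).1 l)) atTop (𝓝 (χ l (z l))) := fun l =>
    ((hz l).comp_tendsto hj.tendsto_atTop) (χ l)
  have h6 : Tendsto (fun n => φ ((0 : C.Weights q), (x (k (j n))).2)) atTop (𝓝 (φ (0, β))) :=
    ((φ.comp (ContinuousLinearMap.inr ℝ _ _)).continuous.tendsto β).comp hβ
  have h7 := (tendsto_finsetSum Finset.univ fun l _ => h5 l).add h6
  rw [hχ]
  exact h7.congr fun n => (hχ (x (k (j n)))).symm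

end CNN

/-! ### Abstract variational convergence -/

section Variational

variable {X : Type*} [NormedAddCommGroup X] [NormedSpace ℝ X]

/-- The direct method of the calculus of variations. -/
theorem exists_isGlobalMin {F : X → ℝ≥0∞} (hF : IsProperFun F)
    (hcomp : ∀ M : ℝ≥0∞, M ≠ ∞ → ∀ x : ℕ → X, (∀ n, F (x n) ≤ M) →
      ∃ z, ∃ k : ℕ → ℕ, StrictMono k ∧ WeaklyTendsto (x ∘ k) z)
    (hlsc : ∀ (x : ℕ → X) (z : X) (M : ℕ → ℝ≥0∞) (c : ℝ≥0∞), WeaklyTendsto x z →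
      Tendsto M atTop (𝓝 c) → (∀ n, F (x n) ≤ M n) → F z ≤ c) : ∃ x, IsGlobalMin F x := by
  obtain ⟨x₀, hx₀⟩ := hF
  obtain ⟨a, -, ha, hmem⟩ := exists_seq_tendsto_sInf (S := Set.range F) ⟨_, x₀, rfl⟩
    (OrderBot.bddBelow _)
  choose x hx using hmem
  have hinf : sInf (Set.range F) < F x₀ + 1 :=
    (sInf_le (Set.mem_range_self x₀)).trans_lt (ENNReal.lt_add_right hx₀ one_ne_zero)
  obtain ⟨N, hN⟩ := eventually_atTop.1 (ha.eventually_lt_const hinf)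
  obtain ⟨z, k, hk, hz⟩ := hcomp (F x₀ + 1) (ENNReal.add_ne_top.2 ⟨hx₀, ENNReal.one_ne_top⟩)
    (fun n => x (n + N)) (fun n => (hx _).le.trans (hN _ (Nat.le_add_left _ _)).le)
  refine ⟨z, fun y => (hlsc _ z (fun n => a (k n + N)) _ hz ?_ fun n => (hx _).le).trans
    (sInf_le (Set.mem_range_self y))⟩
  exact ha.comp ((tendsto_add_atTop_nat N).comp hk.tendsto_atTop)

/-- Convergence of minimizers under equicoercivity, the lower bound along weakly convergent
sequences, and the existence of recovery sequences. -/
theorem tendsto_minimizers {F : ℕ → X → ℝ≥0∞} {G : X → ℝ≥0∞}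
    (hcomp : ∀ M : ℝ≥0∞, M ≠ ∞ → ∀ k : ℕ → ℕ, StrictMono k → ∀ x : ℕ → X,
      (∀ n, F (k n) (x n) ≤ M) → ∃ z, ∃ j : ℕ → ℕ, StrictMono j ∧ WeaklyTendsto (x ∘ j) z)
    (hlow : ∀ k : ℕ → ℕ, StrictMono k → ∀ (x : ℕ → X) (z : X) (M : ℕ → ℝ≥0∞) (c : ℝ≥0∞),
      WeaklyTendsto x z → Tendsto M atTop (𝓝 c) → (∀ n, F (k n) (x n) ≤ M n) → G z ≤ c)
    (hrec : ∀ z, ∃ y : ℕ → X, Tendsto (fun n => F n (y n)) atTop (𝓝 (G z)))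
    {x : ℕ → X} (hx : ∀ n, IsGlobalMin (F n) (x n)) :
    (Tendsto (fun n => F n (x n)) atTop (𝓝 ∞) ∧ ¬ IsProperFun G) ∨
      (IsProperFun G ∧
        (∃ z, IsGlobalMin G z ∧ Tendsto (fun n => F n (x n)) atTop (𝓝 (G z))) ∧
        (∀ z, IsWeakAccPt x z → IsGlobalMin G z) ∧ ∃ z, IsWeakAccPt x z) := by
  have hacc : ∀ z, IsWeakAccPt x z → IsGlobalMin G z := by
    rintro z ⟨k, hk, hz⟩ v
    obtain ⟨y, hy⟩ := hrec v
    exact hlow k hk _ z _ _ hz (hy.comp hk.tendsto_atTop) fun n => hx (k n) (y (k n))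
  have hup : ∀ v c, G v < c → ∀ᶠ n in atTop, F n (x n) < c := by
    intro v c hc
    obtain ⟨y, hy⟩ := hrec v
    filter_upwards [hy.eventually_lt_const hc] with n hn using (hx n (y n)).trans_lt hn
  -- A finite bound along infinitely many indices gives a point with the same bound for the limit.
  have hfreq : ∀ c, c ≠ ∞ → (∃ᶠ n in atTop, F n (x n) ≤ c) →
      ∃ z, IsWeakAccPt x z ∧ G z ≤ c := by
    intro c hc hfr
    obtain ⟨k, hk, hkc⟩ := extraction_of_frequently_atTop hfr
    obtain ⟨z, j, hj, hz⟩ := hcomp c hc k hk (x ∘ k) hkc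
    exact ⟨z, ⟨k ∘ j, hk.comp hj, hz⟩,
      hlow (k ∘ j) (hk.comp hj) _ z _ c hz tendsto_const_nhds fun n => hkc (j n)⟩
  by_cases hG : IsProperFun G
  · right
    obtain ⟨v, hv⟩ := hG
    obtain ⟨z, hz, -⟩ := hfreq (G v + 1) (ENNReal.add_ne_top.2 ⟨hv, ENNReal.one_ne_top⟩)
      ((hup v _ (ENNReal.lt_add_right hv one_ne_zero)).mono fun n hn => hn.le).frequently
    refine ⟨⟨v, hv⟩, ⟨z, hacc z hz, tendsto_order.2 ⟨fun c hc => ?_, hup z⟩⟩, hacc, z, hz⟩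
    by_contra hcon
    obtain ⟨z', -, hz'⟩ := hfreq c (ne_top_of_lt hc)
      ((not_eventually.1 hcon).mono fun n hn => not_lt.1 hn)
    exact absurd ((hacc z hz z').trans hz') (not_le.2 hc)
  · left
    refine ⟨ENNReal.tendsto_nhds_top fun M => ?_, hG⟩
    by_contra hcon
    obtain ⟨z', -, hz'⟩ := hfreq M (ENNReal.natCast_ne_top M)
      ((not_eventually.1 hcon).mono fun n hn => not_lt.1 hn)
    exact hG ⟨z', ne_top_of_le_ne_top (ENNReal.natCast_ne_top M) hz'⟩

end Variational

/-! ### The training problems -/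

theorem Seminorm.continuous_pi {ι : Type*} [Fintype ι] (nrm : Seminorm ℝ (ι → ℝ)) :
    Continuous nrm := by
  rw [← continuousOn_univ]
  exact nrm.convexOn.continuousOn isOpen_univ

theorem Seminorm.exists_pos_mul_norm_le {ι : Type*} [Fintype ι] (nrm : Seminorm ℝ (ι → ℝ))
    (hnrm : ∀ b, nrm b = 0 → b = 0) : ∃ c : ℝ, 0 < c ∧ ∀ b, c * ‖b‖ ≤ nrm b := by
  rcases (Metric.sphere (0 : ι → ℝ) 1).eq_empty_or_nonempty with h0 | hne
  · refine ⟨1, one_pos, fun b => ?_⟩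
    have hb : b = 0 := by
      by_contra hb
      have : ‖b‖⁻¹ • b ∈ Metric.sphere (0 : ι → ℝ) 1 := by simp [norm_smul, hb]
      simp [h0] at this
    simp [hb]
  · obtain ⟨e, he, hmin⟩ := (isCompact_sphere (0 : ι → ℝ) 1).exists_isMinOn hne
      nrm.continuous_pi.continuousOn
    have he0 : nrm e ≠ 0 := fun h => by
      have := hnrm e h
      simp [this] at he
    refine ⟨nrm e, lt_of_le_of_ne (apply_nonneg nrm e) he0.symm, fun b => ?_⟩
    rcases eq_or_ne b 0 with rfl | hb
    · simp
    · have hb0 : 0 < ‖b‖ := norm_pos_iff.2 hb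
      have h1 : nrm e ≤ nrm (‖b‖⁻¹ • b) := hmin (by simp [norm_smul, hb])
      rw [map_smul_eq_mul, norm_inv, norm_norm] at h1
      rwa [le_inv_mul_iff₀ hb0, mul_comm] at h1

namespace CNN

variable {m : ℕ} {C : CNN m} {p q : ℝ≥0∞} [Fact (1 ≤ p)] [Fact (1 ≤ q)] {lam ν : ℝ}
  {nrm : Seminorm ℝ (Fin (m + 1) → ℝ)}

/-- Sublevel sets of the regularizer are weakly sequentially compact. -/
theorem exists_subseq_of_regularizer_le (hpq : p.HolderConjugate q) (hp : p ≠ ∞) (hq : q ≠ ∞)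
    (hlam : 0 < lam) (hν : 0 < ν) (hnrm : ∀ b, nrm b = 0 → b = 0)
    {x : ℕ → C.Params q} {M : ℝ≥0∞} (hM : M ≠ ∞)
    (hx : ∀ n, ENNReal.ofReal (lam * ‖(x n).1‖ + ν * nrm (x n).2) ≤ M) :
    ∃ z, ∃ k : ℕ → ℕ, StrictMono k ∧ WeaklyTendsto (x ∘ k) z := by
  obtain ⟨c, hc, hcb⟩ := nrm.exists_pos_mul_norm_le hnrm
  refine C.exists_subseq_weaklyTendsto hpq hp hq (M := max (M.toReal / lam) (M.toReal / (ν * c)))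
    fun n => ?_
  have h1 : lam * ‖(x n).1‖ + ν * nrm (x n).2 ≤ M.toReal :=
    (ENNReal.ofReal_le_iff_le_toReal hM).1 (hx n)
  have h2 : 0 ≤ lam * ‖(x n).1‖ := by positivity
  have h3 : ν * (c * ‖(x n).2‖) ≤ ν * nrm (x n).2 := mul_le_mul_of_nonneg_left (hcb _) hν.le
  have h4 : 0 ≤ ν * (c * ‖(x n).2‖) := by positivity
  rw [Prod.norm_def]
  refine max_le_max ?_ ?_
  · rw [le_div_iff₀ hlam]; linarith
  · rw [le_div_iff₀ (by positivity)]; linarith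

/-- The regularizer is weakly lower semicontinuous; stated with an additional term. -/
theorem add_regularizer_le_of_weaklyTendsto (hlam : 0 < lam)
    {x : ℕ → C.Params q} {z : C.Params q} (hx : WeaklyTendsto x z) {L M : ℕ → ℝ≥0∞}
    {L₀ M₀ : ℝ≥0∞} (hL : ∀ c < L₀, ∀ᶠ n in atTop, c < L n) (hM : Tendsto M atTop (𝓝 M₀))
    (hle : ∀ n, L n + ENNReal.ofReal (lam * ‖(x n).1‖ + ν * nrm (x n).2) ≤ M n) :
    L₀ + ENNReal.ofReal (lam * ‖z.1‖ + ν * nrm z.2) ≤ M₀ := by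
  -- A norming functional bounds the norm from below along the sequence.
  obtain ⟨g, hg1, hgz⟩ := exists_dual_vector'' ℝ z.1
  have hw : Tendsto (fun n => g (x n).1) atTop (𝓝 ‖z.1‖) := by
    have := hx.map (ContinuousLinearMap.fst ℝ (C.Weights q) (Fin (m + 1) → ℝ)) g
    rw [show g (ContinuousLinearMap.fst ℝ (C.Weights q) (Fin (m + 1) → ℝ) z) = ‖z.1‖ from hgz]
      at this
    exact this
  have hb : Tendsto (fun n => (x n).2) atTop (𝓝 z.2) :=
    (hx.map (ContinuousLinearMap.snd ℝ (C.Weights q) (Fin (m + 1) → ℝ))).tendsto_pi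
  have hR : Tendsto (fun n => ENNReal.ofReal (lam * g (x n).1 + ν * nrm (x n).2)) atTop
      (𝓝 (ENNReal.ofReal (lam * ‖z.1‖ + ν * nrm z.2))) :=
    ENNReal.tendsto_ofReal ((hw.const_mul lam).add
      (((nrm.continuous_pi.tendsto _).comp hb).const_mul ν))
  have hRle : ∀ n, ENNReal.ofReal (lam * g (x n).1 + ν * nrm (x n).2)
      ≤ ENNReal.ofReal (lam * ‖(x n).1‖ + ν * nrm (x n).2) := by
    intro n
    have h1 : g (x n).1 ≤ ‖(x n).1‖ := by
      refine (le_abs_self _).trans ((g.le_opNorm _).trans ?_)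
      exact mul_le_of_le_one_left (norm_nonneg _) hg1
    gcongr
  have hR0 : ENNReal.ofReal (lam * ‖z.1‖ + ν * nrm z.2) ≤ M₀ :=
    le_of_tendsto_of_tendsto' hR hM fun n => (hRle n).trans (le_add_self.trans (hle n))
  have hL0 : L₀ ≤ M₀ - ENNReal.ofReal (lam * ‖z.1‖ + ν * nrm z.2) := by
    refine le_of_forall_lt fun c hc => ?_
    obtain ⟨c', hcc', hc'⟩ := exists_between hc
    refine hcc'.trans_le (ENNReal.le_sub_of_add_le_right ENNReal.ofReal_ne_top ?_)
    refine le_of_tendsto_of_tendsto (tendsto_const_nhds.add hR) hM ?_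
    filter_upwards [hL c' hc'] with n hn using (add_le_add hn.le (hRle n)).trans (hle n)
  calc L₀ + _ ≤ (M₀ - _) + _ := by gcongr
    _ = M₀ := tsub_add_cancel_of_le hR0

end CNN

/-- A sequence along a subsequence of indices, extended to all indices by its limit, converges. -/
theorem tendsto_extend {Y : Type*} [TopologicalSpace Y] {k : ℕ → ℕ} (hk : StrictMono k)
    {z : ℕ → Y} {z₀ : Y} (hz : Tendsto z atTop (𝓝 z₀)) :
    Tendsto (Function.extend k z fun _ => z₀) atTop (𝓝 z₀) := by
  refine tendsto_def.2 fun U hU => ?_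
  obtain ⟨N, hN⟩ := eventually_atTop.1 (hz.eventually hU)
  refine eventually_atTop.2 ⟨k N, fun i hi => ?_⟩
  by_cases h : ∃ n, k n = i
  · obtain ⟨n, rfl⟩ := h
    rw [hk.injective.extend_apply]
    exact hN n (hk.le_iff_le.1 hi)
  · rw [Function.extend_apply' _ _ _ h]
    exact mem_of_mem_nhds hU

namespace CNN

variable {m N : ℕ} {C : CNN m} {p q : ℝ≥0∞} [Fact (1 ≤ q)]
  {Y : Type*} [NormedAddCommGroup Y] [NormedSpace ℝ Y]
  {A : Lp ℝ ∞ C.outRect.vol →L[ℝ] Y} {loss : Y → Y → ℝ≥0∞} {lam ν : ℝ}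
  {nrm : Seminorm ℝ (Fin (m + 1) → ℝ)}

theorem regularizer_le_objectiveH (h : ℝ) (y : Fin N → Y) (u : Fin N → Lp ℝ p C.inRect.vol)
    (x : C.Params q) : ENNReal.ofReal (lam * ‖x.1‖ + ν * nrm x.2)
      ≤ C.objectiveH h A loss lam ν nrm y u x :=
  le_add_self.trans le_self_add

theorem objectiveH_of_mem {h : ℝ} {x : C.Params q} (hx : x.1 ∈ C.discreteWeights q h)
    (y : Fin N → Y) (u : Fin N → Lp ℝ p C.inRect.vol) :
    C.objectiveH h A loss lam ν nrm y u x
      = ∑ j, loss (y j) (A (C.NNh h (u j) x.1 x.2))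
        + ENNReal.ofReal (lam * ‖x.1‖ + ν * nrm x.2) := by
  rw [objectiveH, if_pos hx, add_zero]

theorem mem_discreteWeights_of_objectiveH_ne_top {h : ℝ} {x : C.Params q} {y : Fin N → Y}
    {u : Fin N → Lp ℝ p C.inRect.vol} (hx : C.objectiveH h A loss lam ν nrm y u x ≠ ∞) :
    x.1 ∈ C.discreteWeights q h := by
  by_contra hcon
  exact hx (by rw [objectiveH, if_neg hcon, add_top])

variable [Fact (1 ≤ p)]

/-- The discretized objective functional is weakly sequentially lower semicontinuous. -/
theorem objectiveH_le_of_weaklyTendsto (hact : ∃ K : ℝ≥0, LipschitzWith K C.act)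
    (hcont : C.SamplingContinuous) (hpq : p.HolderConjugate q) (hp : p ≠ ∞) (hlam : 0 < lam)
    {h : ℝ} (hpos : 0 < h) {y : Fin N → Y} {u : Fin N → Lp ℝ p C.inRect.vol}
    (hlsc : ∀ j, LowerSemicontinuous (loss (y j))) {x : ℕ → C.Params q} {z : C.Params q}
    {M : ℕ → ℝ≥0∞} {c : ℝ≥0∞} (hx : WeaklyTendsto x z) (hM : Tendsto M atTop (𝓝 c))
    (hle : ∀ n, C.objectiveH h A loss lam ν nrm y u (x n) ≤ M n) :
    C.objectiveH h A loss lam ν nrm y u z ≤ c := by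
  rcases eq_or_ne c ∞ with rfl | hc
  · exact le_top
  have hw : WeaklyTendsto (fun n => (x n).1) z.1 :=
    hx.map (ContinuousLinearMap.fst ℝ (C.Weights q) (Fin (m + 1) → ℝ))
  have hb : Tendsto (fun n => (x n).2) atTop (𝓝 z.2) :=
    (hx.map (ContinuousLinearMap.snd ℝ (C.Weights q) (Fin (m + 1) → ℝ))).tendsto_pi
  have hmem : z.1 ∈ C.discreteWeights q h := by
    refine C.mem_discreteWeights_of_weaklyTendsto hpq hw ?_
    filter_upwards [hM.eventually_lt_const (lt_top_iff_ne_top.2 hc)] with n hn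
    exact mem_discreteWeights_of_objectiveH_ne_top ((hle n).trans_lt hn).ne
  rw [objectiveH_of_mem hmem]
  refine add_regularizer_le_of_weaklyTendsto hlam hx
    (L := fun n => ∑ j, loss (y j) (A (C.NNh h (u j) (x n).1 (x n).2))) (fun a ha => ?_) hM
    fun n => le_self_add.trans (hle n)
  have hz : Tendsto (fun n (j : Fin N) => A (C.NNh h (u j) (x n).1 (x n).2)) atTop
      (𝓝 fun j => A (C.NNh h (u j) z.1 z.2)) :=
    tendsto_pi_nhds.2 fun j => (A.continuous.tendsto _).comp
      (C.tendsto_NNh_of_res hact hcont hpq hp hpos (u j) hw hb)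
  have hsum : LowerSemicontinuous fun v : Fin N → Y => ∑ j, loss (y j) (v j) :=
    lowerSemicontinuous_sum fun j _ => (hlsc j).comp (continuous_apply j)
  exact hz.eventually (hsum _ a ha)

section Limit

variable (hact : ∃ K : ℝ≥0, LipschitzWith K C.act) (hbounds : C.SamplingBounds)
  (hpq : p.HolderConjugate q) (hp : p ≠ ∞)
  {h : ℕ → ℝ} (hpos : ∀ n, 0 < h n) (hlim : Tendsto h atTop (𝓝 0))
  {u : Fin N → Lp ℝ p C.inRect.vol} {y : Fin N → Y}
  {uh : ℕ → Fin N → Lp ℝ p C.inRect.vol} {yh : ℕ → Fin N → Y}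
  (hdata : ∀ j (z : ℕ → Y) (z₀ : Y), Tendsto z atTop (𝓝 z₀) →
    Tendsto (fun n => loss (yh n j) (z n)) atTop (𝓝 (loss (y j) z₀)))
  (hu : ∀ j, Tendsto (fun n => uh n j) atTop (𝓝 (u j)))

include hact hbounds hpq hp hpos hlim hdata hu

/-- The data terms converge along weakly convergent parameters. -/
theorem tendsto_sum_loss {k : ℕ → ℕ} (hk : StrictMono k) {x : ℕ → C.Params q} {z : C.Params q}
    (hx : WeaklyTendsto x z) :
    Tendsto (fun n => ∑ j, loss (yh (k n) j)
        (A (C.NNh (h (k n)) (uh (k n) j) (x n).1 (x n).2))) atTop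
      (𝓝 (∑ j, loss (y j) (A (C.NN (u j) z.1 z.2)))) := by
  have hw : WeaklyTendsto (fun n => (x n).1) z.1 :=
    hx.map (ContinuousLinearMap.fst ℝ (C.Weights q) (Fin (m + 1) → ℝ))
  have hb : Tendsto (fun n => (x n).2) atTop (𝓝 z.2) :=
    (hx.map (ContinuousLinearMap.snd ℝ (C.Weights q) (Fin (m + 1) → ℝ))).tendsto_pi
  refine tendsto_finsetSum _ fun j _ => ?_
  have h1 : Tendsto (fun n => A (C.NNh (h (k n)) (uh (k n) j) (x n).1 (x n).2)) atTop
      (𝓝 (A (C.NN (u j) z.1 z.2))) :=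
    (A.continuous.tendsto _).comp (C.tendsto_NNh hact hbounds hpq hp (fun n => hpos (k n))
      (hlim.comp hk.tendsto_atTop) ((hu j).comp hk.tendsto_atTop) hw hb)
  have h2 := (hdata j _ _ (tendsto_extend hk h1)).comp hk.tendsto_atTop
  refine h2.congr fun n => ?_
  rw [Function.comp_apply, hk.injective.extend_apply]

/-- The lower bound inequality of variational convergence. -/
theorem objective_le_of_weaklyTendsto (hlam : 0 < lam) {k : ℕ → ℕ} (hk : StrictMono k)
    {x : ℕ → C.Params q} {z : C.Params q} {M : ℕ → ℝ≥0∞} {c : ℝ≥0∞}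
    (hx : WeaklyTendsto x z) (hM : Tendsto M atTop (𝓝 c))
    (hle : ∀ n, C.objectiveH (h (k n)) A loss lam ν nrm (yh (k n)) (uh (k n)) (x n) ≤ M n) :
    C.objective A loss lam ν nrm y u z ≤ c :=
  add_regularizer_le_of_weaklyTendsto hlam hx
    (fun _ ha => (tendsto_sum_loss hact hbounds hpq hp hpos hlim hdata hu hk hx).eventually_const_lt
      ha) hM fun n => le_self_add.trans (hle n)

/-- The existence of recovery sequences. -/
theorem exists_tendsto_objectiveH (hq : q ≠ ∞) (z : C.Params q) :
    ∃ x : ℕ → C.Params q,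
      Tendsto (fun n => C.objectiveH (h n) A loss lam ν nrm (yh n) (uh n) (x n)) atTop
        (𝓝 (C.objective A loss lam ν nrm y u z)) := by
  obtain ⟨w, hw, hwz⟩ := C.exists_discreteWeights_tendsto hq hpos hlim z.1
  have hx : Tendsto (fun n => ((w n, z.2) : C.Params q)) atTop (𝓝 z) :=
    hwz.prodMk_nhds tendsto_const_nhds
  refine ⟨fun n => (w n, z.2), ?_⟩
  refine Tendsto.congr (fun n => (objectiveH_of_mem (x := ((w n, z.2) : C.Params q))
    (hw n) _ _).symm) ?_
  exact (tendsto_sum_loss hact hbounds hpq hp hpos hlim hdata hu strictMono_id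
    (WeaklyTendsto.of_tendsto hx)).add
      (ENNReal.tendsto_ofReal ((hwz.norm.const_mul lam).add tendsto_const_nhds))

end Limit

end CNN

theorem theorem3p11 {m N : ℕ} (C : CNN m)
    (hact : ∃ K : ℝ≥0, LipschitzWith K C.act)
    (hbounds : C.SamplingBounds) (hcont : C.SamplingContinuous)
    (p q : ℝ≥0∞) [Fact (1 ≤ p)] [Fact (1 ≤ q)]
    (hp1 : 1 < p) (hp : p < ∞) (hpq : p.HolderConjugate q)
    {Y : Type*} [NormedAddCommGroup Y] [NormedSpace ℝ Y] [CompleteSpace Y]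
    (A : Lp ℝ ∞ C.outRect.vol →L[ℝ] Y) (loss : Y → Y → ℝ≥0∞)
    (lam ν : ℝ) (hlam : 0 < lam) (hν : 0 < ν)
    (nrm : Seminorm ℝ (Fin (m + 1) → ℝ)) (hnrm : ∀ b, nrm b = 0 → b = 0)
    (h : ℕ → ℝ) (hpos : ∀ n, 0 < h n) (hlim : Tendsto h atTop (𝓝 0))
    (hfits : ∀ n, C.Fits (h n))
    (u : Fin N → Lp ℝ p C.inRect.vol) (y : Fin N → Y)
    (uh : ℕ → Fin N → Lp ℝ p C.inRect.vol) (yh : ℕ → Fin N → Y)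
    (huh : ∀ n j, IsPC C.inRect (h n) (uh n j))
    (hlsc : ∀ n j, LowerSemicontinuous (loss (yh n j)))
    (hfin : ∀ n, ∃ w ∈ C.discreteWeights q (h n), ∃ b : Fin (m + 1) → ℝ,
      ∀ j, loss (yh n j) (A (C.NNh (h n) (uh n j) w b)) < ∞)
    (hdata : ∀ j (z : ℕ → Y) (z₀ : Y), Tendsto z atTop (𝓝 z₀) →
      Tendsto (fun n => loss (yh n j) (z n)) atTop (𝓝 (loss (y j) z₀)))
    (hu : ∀ j, Tendsto (fun n => uh n j) atTop (𝓝 (u j))) :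
    (∀ n, ∃ x : C.Params q,
      IsGlobalMin (C.objectiveH (h n) A loss lam ν nrm (yh n) (uh n)) x) ∧
    ∀ x : ℕ → C.Params q,
      (∀ n, IsGlobalMin (C.objectiveH (h n) A loss lam ν nrm (yh n) (uh n)) (x n)) →
      (Tendsto (fun n => C.objectiveH (h n) A loss lam ν nrm (yh n) (uh n) (x n)) atTop (𝓝 ∞) ∧
        ¬ IsProperFun (fun z : C.Params q => C.objective A loss lam ν nrm y u z)) ∨
      (IsProperFun (fun z : C.Params q => C.objective A loss lam ν nrm y u z) ∧
        (∃ z : C.Params q, IsGlobalMin (C.objective A loss lam ν nrm y u) z ∧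
          Tendsto (fun n => C.objectiveH (h n) A loss lam ν nrm (yh n) (uh n) (x n)) atTop
            (𝓝 (C.objective A loss lam ν nrm y u z))) ∧
        (∀ z, IsWeakAccPt x z → IsGlobalMin (C.objective A loss lam ν nrm y u) z) ∧
        ∃ z, IsWeakAccPt x z) := by
  have hq : q ≠ ∞ := by
    have := hpq.symm
    exact ((ENNReal.HolderConjugate.lt_top_iff_one_lt q p).2 hp1).ne
  refine ⟨fun n => ?_, fun x hx => ?_⟩
  · refine exists_isGlobalMin ?_ (fun M hM x hx => ?_) fun x z M c hxz hM hle => ?_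
    · obtain ⟨w, hw, b, hb⟩ := hfin n
      refine ⟨(w, b), ?_⟩
      rw [CNN.objectiveH_of_mem hw]
      exact ENNReal.add_ne_top.2 ⟨ENNReal.sum_ne_top.2 fun j _ => (hb j).ne,
        ENNReal.ofReal_ne_top⟩
    · exact CNN.exists_subseq_of_regularizer_le hpq hp.ne hq hlam hν hnrm hM fun i =>
        (CNN.regularizer_le_objectiveH _ _ _ _).trans (hx i)
    · exact CNN.objectiveH_le_of_weaklyTendsto hact hcont hpq hp.ne hlam (hpos n) (hlsc n) hxz hM
        hle
  · refine tendsto_minimizers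
      (F := fun n => C.objectiveH (h n) A loss lam ν nrm (yh n) (uh n))
      (fun M hM k _ x hx => ?_) (fun k hk x z M c hxz hM hle => ?_) (fun z => ?_) hx
    · exact CNN.exists_subseq_of_regularizer_le hpq hp.ne hq hlam hν hnrm hM fun i =>
        (CNN.regularizer_le_objectiveH _ _ _ _).trans (hx i)
    · exact CNN.objective_le_of_weaklyTendsto hact hbounds hpq hp.ne hpos hlim hdata hu hlam hk
        hxz hM hle
    · exact CNN.exists_tendsto_objectiveH hact hbounds hpq hp.ne hpos hlim hdata hu hq z

end
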